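/- Let $N\ge 1$ and let $F_1,\dots,F_R:2^{[N]}\to\mathbb{R}$ be submodular with $F_r(\emptyset)=0$ and $F_r\ge 0$. Let $B_r=\{y\in\mathbb{R}^N: y(S)\le F_r(S)\ \forall S\subseteq[N],\ y([N])=F_r([N])\}$, where $y(S)=\sum_{i\in S}y_i$, be the base polytope of $F_r$, let $C_r=\{(y_r,\phi_r):\phi_r\ge 0,\ y_r\in\phi_rB_r\}$, and let $S_r$ be the set of all $i\in[N]$ with $F_r(S)\ne F_r(S\cup\{i\})$ for some $S$. Assume that every $i\in[N]$ lies in some $S_r$. Let $a\in\mathbb{R}^N$, $\beta>0$ and $W=\beta D$, where $D$ is the diagonal matrix with $D_{ii}=\sum_{r:\,i\in S_r}\max_{S\subseteq[N]}F_r(S)^2$ (so $D_{ii}>0$). Write $\|x\|_{W^{-1}}^2=\sum_i x_i^2/W_{ii}$, and consider the dual problem of minimizing $$g(y,\phi)=\Big\|\sum_{r}y_r-2Wa\Big\|_{W^{-1}}^2+\sum_{r}\phi_r^2\qquad\text{over }(y_r,\phi_r)\in C_r,\ r\in[R],$$ with optimal value $g^*$ and set of minimizers $\Xi$. Let $$E(y,\phi)=g(y,\phi)-g^*+\min_{(y',\phi')\in\Xi}\sum_r\big(\|y_r-y'_r\|_{W^{-1}}^2+(\phi_r-\phi'_r)^2\big).$$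 Random coordinate descent (RCD) starts at a feasible $(y^{(0)},\phi^{(0)})$ with $y^{(0)}=0$ (for instance $\phi^{(0)}=0$). In iteration $k$ it picks $r\in[R]$ uniformly at random, independently of the earlier picks, replaces $(y_r,\phi_r)$ by the minimizer of $\|y_r-b\|_{W^{-1}}^2+\phi_r^2$ over $C_r$, where $b=2Wa-\sum_{r'\ne r}y^{(k)}_{r'}$, and leaves all other components unchanged. Put $E_k=E(y^{(k)},\phi^{(k)})$ and $$K=N^2R\,\max\{1,9\beta^{-1}\}\,\max_{i,j\in[N]}\frac{D_{ii}}{D_{jj}} .$$ Then there is a universal constant $C>0$ such that the following holds for all such data and all $0<\varepsilon\le\frac12$. (i) The expected number of RCD iterations until $E_k\le\varepsilon E_0$ for the first time is at most $CK\log\frac1\varepsilon$, and $\mathbb{E}[E_k]\le\varepsilon E_0$ for all $k\ge CK\log\frac1\varepsilon$. (ii) If moreover $\varepsilon E_0\le 1$, then the expected number of RCD iterations until $E_k\le\varepsilon$ for the first time is at most $CK\log\frac1\varepsilon$, and $\mathbb{E}[E_k]\le\varepsilon$ for all $k\ge CK\log\frac1\varepsilon$. In particular, RCD needs an expected $O\big(N^2R\max\{1,9/\beta\}\max_{i,j}\frac{D_{ii}}{D_{jj}}\log\frac1\varepsilon\big)$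 iterations to reach an $\varepsilon$-optimal solution. -/

import Mathlib

open MeasureTheory ProbabilityTheory
open scoped Pointwise ENNReal

noncomputable section

namespace QDSFM

/-- A set function on `[N]` that is submodular, normalized and nonnegative. -/
structure IsAdmissible {N : ℕ} (F : Finset (Fin N) → ℝ) : Prop where
  submodular : ∀ S T, F (S ∪ T) + F (S ∩ T) ≤ F S + F T
  normalized : F ∅ = 0
  nonneg : ∀ S, 0 ≤ F S

/-- The set of elements that are incident to `F`. -/
def incidentSet {N : ℕ} (F : Finset (Fin N) → ℝ) : Set (Fin N) :=
  {i | ∃ S, F S ≠ F (insert i S)}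

/-- The base polytope of `F`. -/
def basePolytope {N : ℕ} (F : Finset (Fin N) → ℝ) : Set (Fin N → ℝ) :=
  {y | (∀ S : Finset (Fin N), ∑ i ∈ S, y i ≤ F S) ∧ ∑ i, y i = F Finset.univ}

/-- The cone `{(y, φ) | φ ≥ 0, y ∈ φ B}` over the base polytope `B` of `F`. -/
def cone {N : ℕ} (F : Finset (Fin N) → ℝ) : Set ((Fin N → ℝ) × ℝ) :=
  {p | 0 ≤ p.2 ∧ p.1 ∈ p.2 • basePolytope F}

/-- The squared weighted norm `∑ i, w i * x i ^ 2`; a positive diagonal matrix is given by the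
vector `w` of its diagonal entries, and its inverse by `w⁻¹`. -/
def wnormSq {N : ℕ} (w x : Fin N → ℝ) : ℝ := ∑ i, w i * x i ^ 2

open Classical in
/-- The diagonal degree matrix: `D i` is the sum of `max_S F_r(S) ^ 2` over all `r` to which `i`
is incident. -/
def degree {N R : ℕ} (F : Fin R → Finset (Fin N) → ℝ) (i : Fin N) : ℝ :=
  ∑ r, if i ∈ incidentSet (F r) then ⨆ S : Finset (Fin N), F r S ^ 2 else 0

/-- The feasible set of the dual problem, the product of the cones. A dual variable is a family
`z` with `z r = (y_r, φ_r)`. -/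
def feasible {N R : ℕ} (F : Fin R → Finset (Fin N) → ℝ) : Set (Fin R → (Fin N → ℝ) × ℝ) :=
  {z | ∀ r, z r ∈ cone (F r)}

/-- The dual objective `‖∑ r, y_r - 2 W a‖² + ∑ r, φ_r²`, with the `W⁻¹`-norm. -/
def dualObj {N R : ℕ} (W a : Fin N → ℝ) (z : Fin R → (Fin N → ℝ) × ℝ) : ℝ :=
  wnormSq W⁻¹ ((∑ r, (z r).1) - (2 : ℝ) • (W * a)) + ∑ r, (z r).2 ^ 2

/-- The set of optimal solutions of the dual problem. -/
def dualSolutions {N R : ℕ} (F : Fin R → Finset (Fin N) → ℝ) (W a : Fin N → ℝ) :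
    Set (Fin R → (Fin N → ℝ) × ℝ) :=
  {z | z ∈ feasible F ∧ IsMinOn (dualObj W a) (feasible F) z}

/-- The optimal value of the dual problem. -/
def dualOpt {N R : ℕ} (F : Fin R → Finset (Fin N) → ℝ) (W a : Fin N → ℝ) : ℝ :=
  ⨅ z : feasible F, dualObj W a z.1

/-- The squared distance of `z` to the set of optimal dual solutions, with the `W⁻¹`-norm on each
`y_r` and the Euclidean norm on `φ`. -/
def distSqSolutions {N R : ℕ} (F : Fin R → Finset (Fin N) → ℝ) (W a : Fin N → ℝ)
    (z : Fin R → (Fin N → ℝ) × ℝ) : ℝ :=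
  ⨅ z' : dualSolutions F W a,
    ∑ r, (wnormSq W⁻¹ ((z r).1 - (z'.1 r).1) + ((z r).2 - (z'.1 r).2) ^ 2)

/-- The error of a dual point: its suboptimality plus its squared distance to the set of optimal
solutions. -/
def dualError {N R : ℕ} (F : Fin R → Finset (Fin N) → ℝ) (W a : Fin N → ℝ)
    (z : Fin R → (Fin N → ℝ) × ℝ) : ℝ :=
  dualObj W a z - dualOpt F W a + distSqSolutions F W a z

/-- The projection of `b` onto the cone of `F`: the (unique) minimizer of
`‖y - b‖² + φ²` over the cone, with the `W⁻¹`-norm. -/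
def coneProj {N : ℕ} (W : Fin N → ℝ) (F : Finset (Fin N) → ℝ) (b : Fin N → ℝ) :
    (Fin N → ℝ) × ℝ :=
  Classical.epsilon fun p => p ∈ cone F ∧
    IsMinOn (fun q : (Fin N → ℝ) × ℝ => wnormSq W⁻¹ (q.1 - b) + q.2 ^ 2) (cone F) p

/-- One iteration of random coordinate descent, when the component `r` has been picked. -/
def rcdStep {N R : ℕ} (F : Fin R → Finset (Fin N) → ℝ) (W a : Fin N → ℝ)
    (z : Fin R → (Fin N → ℝ) × ℝ) (r : Fin R) : Fin R → (Fin N → ℝ) × ℝ :=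
  Function.update z r
    (coneProj W (F r) ((2 : ℝ) • (W * a) - ∑ r' ∈ Finset.univ.erase r, (z r').1))

/-- The iterates of random coordinate descent from `z₀`, when the component picked in iteration
`k` is `idx k`. -/
def rcdIter {N R : ℕ} (F : Fin R → Finset (Fin N) → ℝ) (W a : Fin N → ℝ)
    (z₀ : Fin R → (Fin N → ℝ) × ℝ) (idx : ℕ → Fin R) : ℕ → Fin R → (Fin N → ℝ) × ℝ
  | 0 => z₀
  | k + 1 => rcdStep F W a (rcdIter F W a z₀ idx k) (idx k)

/-- The number of iterations until the error is at most `η` for the first time (`∞` if this never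
happens). -/
def iterationsToError {N R : ℕ} (F : Fin R → Finset (Fin N) → ℝ) (W a : Fin N → ℝ)
    (z₀ : Fin R → (Fin N → ℝ) × ℝ) (idx : ℕ → Fin R) (η : ℝ) : ℝ≥0∞ :=
  ⨅ (k : ℕ) (_ : dualError F W a (rcdIter F W a z₀ idx k) ≤ η), (k : ℝ≥0∞)

/-- `idx` is a sequence of independent random components, each uniform on `[R]`. -/
structure IsUniformSampling {Ω : Type*} [MeasurableSpace Ω] (μ : Measure Ω) {R : ℕ}
    (idx : ℕ → Ω → Fin R) : Prop where
  measurable : ∀ k, Measurable (idx k)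
  indep : iIndepFun idx μ
  uniform : ∀ k r, μ (idx k ⁻¹' {r}) = (R : ℝ≥0∞)⁻¹

/-- The factor `N² R max{1, 9/β} max_{i,j} D_ii / D_jj`. -/
def complexityFactor {N R : ℕ} (F : Fin R → Finset (Fin N) → ℝ) (β : ℝ) : ℝ :=
  (N : ℝ) ^ 2 * R * max 1 (9 * β⁻¹) * ⨆ p : Fin N × Fin N, degree F p.1 / degree F p.2

end QDSFM

end

/-! The dual objective is quadratic but not strongly convex: it sees the `y_r` only through their
sum. Minimality gives growth only in the aggregate quantity `aggSq`, the squared deviation of `∑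
y_r` and of `φ`; hence all optimal solutions share their sum and multipliers. Linear convergence
therefore rests on an error bound: the squared distance to the solution set is at most `4 N² max{1,
9/β} max (D_ii/D_jj)` times `aggSq` (`exists_sqNorm_sub_le`, `distSqSolutions_le_aggSq`).

The error bound is combinatorial. With the multipliers fixed, points of base polytopes are moved to
a prescribed sum by augmenting paths in the exchange graph of tight sets. Each augmentation changes
every coordinate, summed over `r`, by no more than it decreases the `ℓ¹`-distance of the sums
(`exists_augmentation`, `exists_redistribution`).

Exact minimization over one block satisfies a three-point inequality (`dualObj_rcdStep_add_le`).
Averaged over `r`, it bounds suboptimality plus squared distance together, with gain `g(z) - g* +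
aggSq`. The error bound turns this into contraction of the expected error by `1 - 1/(4K)` per
iteration (`sum_dualError_rcdStep_le`, `integral_dualError_le`). Markov's inequality and a geometric
series then bound the expected hitting time (`lintegral_hitting_le`). Absolute accuracy `ε` follows
from relative accuracy `ε²`, since `ε² E₀ ≤ ε` when `ε E₀ ≤ 1`. -/

namespace QDSFM

open Filter Topology

/-! ### Tight sets, augmenting paths and redistribution between base polytopes. -/

section Exchange

variable {N : ℕ}

/-- A set is tight for `y` if the submodular constraint is attained on it. -/
def Tight (G : Finset (Fin N) → ℝ) (y : Fin N → ℝ) (S : Finset (Fin N)) : Prop :=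
  ∑ i ∈ S, y i = G S

lemma tight_union_inter {G : Finset (Fin N) → ℝ} (hG : IsAdmissible G) {y : Fin N → ℝ}
    (hy : y ∈ basePolytope G) {S T : Finset (Fin N)} (hS : Tight G y S) (hT : Tight G y T) :
    Tight G y (S ∪ T) ∧ Tight G y (S ∩ T) := by
  have h := hG.submodular S T
  have h1 := hy.1 (S ∪ T)
  have h2 := hy.1 (S ∩ T)
  have h3 := Finset.sum_union_inter (s₁ := S) (s₂ := T) (f := y)
  unfold Tight at *
  constructor <;> linarith

/-- Tight sets form a lattice containing `∅` and the ground set, and `U` is the union over `j ∈ U`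
of the intersections over `i ∉ U` of the separating tight sets. -/
lemma tight_of_separated {G : Finset (Fin N) → ℝ} (hG : IsAdmissible G) {y : Fin N → ℝ}
    (hy : y ∈ basePolytope G) (U : Finset (Fin N))
    (h : ∀ j ∈ U, ∀ i, i ∉ U → ∃ S, Tight G y S ∧ j ∈ S ∧ i ∉ S) : Tight G y U := by
  classical
  choose! S hS using h
  have key : U = U.sup fun j => Uᶜ.inf (S j) := by
    apply le_antisymm
    · intro j hj
      refine (Finset.le_sup (f := fun j => Uᶜ.inf (S j)) hj) ?_
      rw [Finset.mem_inf]
      intro i hi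
      exact (hS j hj i (Finset.mem_compl.1 hi)).2.1
    · refine Finset.sup_le fun j hj i hi => ?_
      by_contra hiU
      rw [Finset.mem_inf] at hi
      exact (hS j hj i hiU).2.2 (hi i (Finset.mem_compl.2 hiU))
  rw [key]
  refine Finset.sup_induction (p := Tight G y) ?_ ?_ ?_
  · simp [Tight, hG.normalized]
  · intro A hA B hB
    exact (tight_union_inter hG hy hA hB).1
  · intro j hj
    refine Finset.inf_induction (p := Tight G y) hy.2 ?_ ?_
    · intro A hA B hB
      exact (tight_union_inter hG hy hA hB).2
    · intro i hi
      exact (hS j hj i (Finset.mem_compl.1 hi)).1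

/-- Directions that do not increase the tight constraints are feasible. -/
lemma eventually_mem_basePolytope {G : Finset (Fin N) → ℝ} {y d : Fin N → ℝ}
    (hy : y ∈ basePolytope G) (hd : ∀ S, Tight G y S → ∑ i ∈ S, d i ≤ 0)
    (hd0 : ∑ i, d i = 0) : ∀ᶠ t : ℝ in 𝓝[>] 0, y + t • d ∈ basePolytope G := by
  have h : ∀ S : Finset (Fin N), ∀ᶠ t : ℝ in 𝓝[>] 0, ∑ i ∈ S, (y i + t * d i) ≤ G S := by
    intro S
    rcases (hy.1 S).lt_or_eq with hlt | heq
    · have hc : ContinuousAt (fun t : ℝ => ∑ i ∈ S, (y i + t * d i)) 0 := by fun_prop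
      have := Filter.Tendsto.eventually_lt_const (u := G S) (by simpa using hlt) hc.tendsto
      filter_upwards [this.filter_mono nhdsWithin_le_nhds] with t ht using ht.le
    · filter_upwards [self_mem_nhdsWithin] with t ht
      have := hd S heq
      rw [Finset.sum_add_distrib, ← Finset.mul_sum]
      have := mul_nonpos_of_nonneg_of_nonpos (le_of_lt (Set.mem_Ioi.1 ht)) this
      linarith
  filter_upwards [eventually_all.2 h] with t ht
  refine ⟨fun S => by simpa using ht S, ?_⟩
  simp [Finset.sum_add_distrib, ← Finset.mul_sum, hd0, hy.2]

/-- A shortest walk is injective. -/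
lemma exists_injOn_walk {α : Type*} (rel : α → α → Prop) {s t : α}
    (h : Relation.ReflTransGen rel s t) :
    ∃ (m : ℕ) (p : ℕ → α), p 0 = s ∧ p m = t ∧ (∀ k < m, rel (p k) (p (k + 1))) ∧
      Set.InjOn p (Set.Iic m) := by
  classical
  have hex : ∃ m, ∃ p : ℕ → α, p 0 = s ∧ p m = t ∧ ∀ k < m, rel (p k) (p (k + 1)) := by
    induction h with
    | refl => exact ⟨0, fun _ => s, rfl, rfl, by simp⟩
    | @tail b c _ hbc ih =>
      obtain ⟨m, p, h0, hm, hp⟩ := ih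
      refine ⟨m + 1, fun k => if k ≤ m then p k else c, by simp [h0], by simp, fun k hk => ?_⟩
      rcases (Nat.lt_succ_iff.1 hk).lt_or_eq with h | h
      · simpa [h.le, Nat.succ_le_of_lt h] using hp k h
      · subst h
        simpa [hm] using hbc
  obtain ⟨p, h0, hm, hp⟩ := Nat.find_spec hex
  refine ⟨Nat.find hex, p, h0, hm, hp, ?_⟩
  set m := Nat.find hex with hmdef
  -- A repetition `p a = p b` would allow the loop between `a` and `b` to be cut out, contradicting
  -- minimality of `m`.
  have hlt : ∀ a b, a < b → b ≤ m → p a ≠ p b := by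
    intro a b hab hb he
    have : ∃ q : ℕ → α, q 0 = s ∧ q (m - (b - a)) = t ∧
        ∀ k < m - (b - a), rel (q k) (q (k + 1)) := by
      refine ⟨fun k => if k ≤ a then p k else p (k + (b - a)), by simp [h0], ?_, ?_⟩
      · by_cases hba : m - (b - a) ≤ a
        · have e1 : m = b := by omega
          have e2 : m - (b - a) = a := by omega
          simp only [e2, le_refl, if_true]
          rw [he, ← e1, hm]
        · simp only [hba, if_false]
          rw [Nat.sub_add_cancel (by omega), hm]
      · intro k hk
        rcases lt_trichotomy k a with h | h | h
        · have : k + 1 ≤ a := h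
          simpa [h.le, this] using hp k (by omega)
        · subst h
          have := hp b (by omega)
          have e : k + 1 + (b - k) = b + 1 := by omega
          simpa [he, e] using this
        · have h1 : ¬ k ≤ a := by omega
          have h2 : ¬ k + 1 ≤ a := by omega
          have := hp (k + (b - a)) (by omega)
          have e : k + 1 + (b - a) = k + (b - a) + 1 := by omega
          simpa [h1, h2, e] using this
    exact Nat.find_min hex (by omega) this
  intro a ha b hb he
  rcases lt_trichotomy a b with h | h | h
  · exact absurd he (hlt a b h hb)
  · exact h
  · exact absurd he.symm (hlt b a h ha)

variable {ι : Type*} [Fintype ι]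

/-- If the sums of two families in the base polytopes differ, then there is an augmenting path
from an element where the first sum is too large to one where it is too small. -/
lemma exists_augmenting_path {G : ι → Finset (Fin N) → ℝ} (hG : ∀ r, IsAdmissible (G r))
    {y x : ι → Fin N → ℝ} (hy : ∀ r, y r ∈ basePolytope (G r))
    (hx : ∀ r, x r ∈ basePolytope (G r)) (hne : ∑ r, y r ≠ ∑ r, x r) :
    ∃ s t, ∑ r, x r s < ∑ r, y r s ∧ ∑ r, y r t < ∑ r, x r t ∧
      Relation.ReflTransGen
        (fun i j => ∃ r, ∀ S, Tight (G r) (y r) S → j ∈ S → i ∈ S) s t := by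
  classical
  set rel : Fin N → Fin N → Prop :=
    fun i j => ∃ r, ∀ S, Tight (G r) (y r) S → j ∈ S → i ∈ S with hrel
  by_contra hcon
  push Not at hcon
  have htot : ∑ i, ∑ r, y r i = ∑ i, ∑ r, x r i := by
    rw [Finset.sum_comm, Finset.sum_comm (f := fun i r => x r i)]
    exact Finset.sum_congr rfl fun r _ => by rw [(hy r).2, (hx r).2]
  obtain ⟨t₀, ht₀⟩ : ∃ t, ∑ r, y r t < ∑ r, x r t := by
    by_contra hno
    push Not at hno
    apply hne
    have := (Finset.sum_eq_sum_iff_of_le (fun i _ => hno i)).1 htot.symm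
    ext i
    simpa using (this i (Finset.mem_univ i)).symm
  -- `U` consists of the elements from which a deficient element can be reached. No arc enters `U`
  -- from outside, so `U` is tight for every `r`. Then `x` cannot exceed `y` on `U` in total, which
  -- forces an excess element in `U`.
  let U : Finset (Fin N) := Finset.univ.filter fun i =>
    ∃ t, ∑ r, y r t < ∑ r, x r t ∧ Relation.ReflTransGen rel i t
  have htight : ∀ r, Tight (G r) (y r) U := by
    intro r
    refine tight_of_separated (hG r) (hy r) U fun j hj i hi => ?_
    by_contra hS
    push Not at hS
    obtain ⟨t, ht, hjt⟩ := (Finset.mem_filter.1 hj).2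
    exact hi (Finset.mem_filter.2 ⟨Finset.mem_univ _, t, ht,
      Relation.ReflTransGen.head ⟨r, hS⟩ hjt⟩)
  have h1 : ∑ i ∈ U, ∑ r, x r i ≤ ∑ i ∈ U, ∑ r, y r i := by
    rw [Finset.sum_comm, Finset.sum_comm (f := fun i r => y r i)]
    exact Finset.sum_le_sum fun r _ => by rw [htight r]; exact (hx r).1 U
  have h2 : ∑ i ∈ U, ∑ r, y r i < ∑ i ∈ U, ∑ r, x r i := by
    refine Finset.sum_lt_sum (fun i hi => ?_) ⟨t₀, ?_, ht₀⟩
    · obtain ⟨t, ht, hit⟩ := (Finset.mem_filter.1 hi).2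
      by_contra hlt
      exact hcon i t (not_le.1 hlt) ht hit
    · exact Finset.mem_filter.2 ⟨Finset.mem_univ _, t₀, ht₀, Relation.ReflTransGen.refl⟩
  linarith

/-- A small amount `t` is pushed along an injective augmenting path, each arc being charged to one
`r` that permits it. Only the endpoints change in the total sum, so the `ℓ¹`-distance drops by `2 *
t`, while injectivity bounds the movement at each element by the same `2 * t`. -/
lemma exists_augmentation {G : ι → Finset (Fin N) → ℝ} (hG : ∀ r, IsAdmissible (G r))
    {y x : ι → Fin N → ℝ} (hy : ∀ r, y r ∈ basePolytope (G r))
    (hx : ∀ r, x r ∈ basePolytope (G r)) (hne : ∑ r, y r ≠ ∑ r, x r) :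
    ∃ (t : ℝ) (d : ι → Fin N → ℝ), 0 < t ∧ (∀ r, y r + t • d r ∈ basePolytope (G r)) ∧
      (∀ i, ∑ r, |d r i| ≤ 2) ∧
      ∑ i, |∑ r, (y r i + t * d r i) - ∑ r, x r i| = ∑ i, |∑ r, y r i - ∑ r, x r i| - 2 * t := by
  classical
  obtain ⟨s, e, hs, he, hpath⟩ := exists_augmenting_path hG hy hx hne
  obtain ⟨m, p, hp0, hpm, harc, hinj⟩ := exists_injOn_walk _ hpath
  have : Nonempty ι := by
    by_contra h
    rw [not_nonempty_iff] at h
    exact hne (by simp)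
  choose! c hc using harc
  let δ : Fin N → Fin N → ℝ := fun j i => if j = i then 1 else 0
  let d : ι → Fin N → ℝ := fun r i =>
    ∑ k ∈ Finset.range m, if c k = r then δ (p (k + 1)) i - δ (p k) i else 0
  have hδ : ∀ (S : Finset (Fin N)) j, ∑ i ∈ S, δ j i = if j ∈ S then 1 else 0 := by
    intro S j; simp [δ]
  have hdS : ∀ r S, ∑ i ∈ S, d r i = ∑ k ∈ Finset.range m,
      if c k = r then (if p (k + 1) ∈ S then (1 : ℝ) else 0) - (if p k ∈ S then 1 else 0)
        else 0 := by
    intro r S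
    simp only [d]
    rw [Finset.sum_comm]
    refine Finset.sum_congr rfl fun k _ => ?_
    split_ifs <;> simp_all [Finset.sum_sub_distrib]
  have hdsum : ∀ i, ∑ r, d r i = δ e i - δ s i := by
    intro i
    simp only [d]
    rw [Finset.sum_comm]
    simp only [Finset.sum_ite_eq, Finset.mem_univ, if_true]
    rw [Finset.sum_range_sub (fun k => δ (p k) i), hp0, hpm]
  have hdabs : ∀ i, ∑ r, |d r i| ≤ 2 := by
    intro i
    -- An injective path enters each vertex at most once and leaves it at most once; this is the
    -- source of the bound `2`.
    have hcount : ∀ f : ℕ → ℕ, Set.InjOn (fun k => p (f k)) (Finset.range m) →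
        ∑ k ∈ Finset.range m, δ (p (f k)) i ≤ 1 := by
      intro f hf
      simp only [δ]
      rw [Finset.sum_boole]
      have : ((Finset.range m).filter fun k => p (f k) = i).card ≤ 1 := by
        rw [Finset.card_le_one]
        intro a ha b hb
        rw [Finset.mem_filter] at ha hb
        exact hf ha.1 hb.1 (ha.2.trans hb.2.symm)
      exact_mod_cast this
    have hδ0 : ∀ j, 0 ≤ δ j i := by intro j; simp only [δ]; split_ifs <;> norm_num
    calc ∑ r, |d r i| ≤ ∑ r, ∑ k ∈ Finset.range m,
          (if c k = r then δ (p (k + 1)) i + δ (p k) i else 0) := by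
          refine Finset.sum_le_sum fun r _ => (Finset.abs_sum_le_sum_abs _ _).trans
            (Finset.sum_le_sum fun k _ => ?_)
          split_ifs
          · rw [abs_le]
            constructor <;> linarith [hδ0 (p (k + 1)), hδ0 (p k)]
          · simp
      _ = ∑ k ∈ Finset.range m, (δ (p (k + 1)) i + δ (p k) i) := by
          rw [Finset.sum_comm]
          simp
      _ ≤ 2 := by
          rw [Finset.sum_add_distrib]
          have h1 := hcount (fun k => k + 1) fun a ha b hb hab => by
            have := hinj (Set.mem_Iic.2 (by simpa using ha)) (Set.mem_Iic.2 (by simpa using hb)) hab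
            omega
          have h2 := hcount (fun k => k) fun a ha b hb hab =>
            hinj (Set.mem_Iic.2 (by simp at ha; omega)) (Set.mem_Iic.2 (by simp at hb; omega)) hab
          linarith
  -- Each arc separately does not increase any tight constraint, hence neither does the sum of the
  -- arcs assigned to `r`. For small `t` this is enough, so simultaneous exchanges do not interfere.
  have hfeas : ∀ r, ∀ᶠ t : ℝ in 𝓝[>] 0, y r + t • d r ∈ basePolytope (G r) := by
    intro r
    refine eventually_mem_basePolytope (hy r) (fun S hS => ?_) ?_
    · rw [hdS]
      refine Finset.sum_nonpos fun k hk => ?_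
      split_ifs with h1 h2 h3 h3
      · simp
      · exact absurd (hc k (Finset.mem_range.1 hk) S (h1 ▸ hS) h2) h3
      · simp
      · simp
      · simp
    · rw [hdS]; simp
  have hsmall : ∀ᶠ t : ℝ in 𝓝[>] 0, t < ∑ r, y r s - ∑ r, x r s ∧
      t < ∑ r, x r e - ∑ r, y r e := by
    refine (Filter.Eventually.and ?_ ?_).filter_mono nhdsWithin_le_nhds
    · exact eventually_lt_nhds (by linarith)
    · exact eventually_lt_nhds (by linarith)
  obtain ⟨t, ht, ⟨ht1, ht2⟩, htpos⟩ :=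
    ((eventually_all.2 hfeas).and (hsmall.and self_mem_nhdsWithin)).exists
  have htpos : 0 < t := htpos
  refine ⟨t, d, htpos, ht, hdabs, ?_⟩
  have hse : s ≠ e := by rintro rfl; linarith
  have hpt : ∀ i, |∑ r, (y r i + t * d r i) - ∑ r, x r i| =
      |∑ r, y r i - ∑ r, x r i| - t * δ e i - t * δ s i := by
    intro i
    rw [Finset.sum_add_distrib, ← Finset.mul_sum, hdsum]
    simp only [δ]
    rcases eq_or_ne e i with rfl | h1
    · rw [if_neg hse, if_pos rfl, abs_of_nonpos (by linarith), abs_of_neg (by linarith)]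
      ring
    · rcases eq_or_ne s i with rfl | h2
      · rw [if_neg h1, if_pos rfl, abs_of_nonneg (by linarith), abs_of_pos (by linarith)]
        ring
      · rw [if_neg h1, if_neg h2]
        simp
  simp only [hpt]
  rw [Finset.sum_sub_distrib, Finset.sum_sub_distrib, ← Finset.mul_sum, ← Finset.mul_sum, hδ, hδ,
    if_pos (Finset.mem_univ _), if_pos (Finset.mem_univ _)]
  ring

/-- Families in base polytopes can be moved to a prescribed sum at a cost, at each element, of at
most the `ℓ¹`-distance of the sums. -/
theorem exists_redistribution {G : ι → Finset (Fin N) → ℝ} (hG : ∀ r, IsAdmissible (G r))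
    {y x : ι → Fin N → ℝ} (hy : ∀ r, y r ∈ basePolytope (G r))
    (hx : ∀ r, x r ∈ basePolytope (G r)) :
    ∃ y' : ι → Fin N → ℝ, (∀ r, y' r ∈ basePolytope (G r)) ∧ ∑ r, y' r = ∑ r, x r ∧
      ∀ i, ∑ r, |y' r i - y r i| ≤ ∑ j, |∑ r, y r j - ∑ r, x r j| := by
  set L : (ι → Fin N → ℝ) → ℝ := fun u => ∑ j, |∑ r, u r j - ∑ r, x r j| with hL
  -- Membership in `A` says that the movement so far is paid for by the decrease of `L`, a property
  -- preserved by augmentation. Minimizing `L` over the compact set `A` replaces a possibly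
  -- nonterminating sequence of augmentations.
  let A : Set (ι → Fin N → ℝ) := {u | (∀ r, (∀ S : Finset (Fin N), ∑ i ∈ S, u r i ≤ G r S) ∧
    ∑ i, u r i = G r Finset.univ) ∧ ∀ i, ∑ r, |u r i - y r i| ≤ L y - L u}
  have hLc : Continuous L := by fun_prop
  have hL0 : ∀ u, 0 ≤ L u := fun u => Finset.sum_nonneg fun _ _ => abs_nonneg _
  have hAcl : IsClosed A := by
    simp only [A, Set.ofPred_and, Set.ofPred_forall]
    refine (isClosed_iInter fun r => (isClosed_iInter fun S => ?_).inter ?_).inter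
      (isClosed_iInter fun i => ?_)
    · exact isClosed_le (by fun_prop) (by fun_prop)
    · exact isClosed_eq (by fun_prop) (by fun_prop)
    · exact isClosed_le (by fun_prop) (by fun_prop)
  have hAsub : A ⊆ Set.Icc (fun r i => y r i - L y) (fun r i => y r i + L y) := by
    intro u hu
    have : ∀ r i, |u r i - y r i| ≤ L y := fun r i =>
      (Finset.single_le_sum (f := fun r => |u r i - y r i|) (fun _ _ => abs_nonneg _)
        (Finset.mem_univ r)).trans ((hu.2 i).trans (by linarith [hL0 u]))
    constructor <;> intro r i <;> have := abs_le.1 (this r i) <;> simp only <;> linarith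
  have hAc : IsCompact A := isCompact_Icc.of_isClosed_subset hAcl hAsub
  obtain ⟨u, hu, hmin⟩ := hAc.exists_isMinOn ⟨y, hy, by simp⟩ hLc.continuousOn
  refine ⟨u, hu.1, ?_, fun i => (hu.2 i).trans (by linarith [hL0 u])⟩
  by_contra hne
  obtain ⟨t, d, ht, hfeas, hd, hdec⟩ := exists_augmentation hG hu.1 hx hne
  have hLu : L (fun r => u r + t • d r) = L u - 2 * t := hdec
  have hmem : (fun r => u r + t • d r) ∈ A := by
    refine ⟨hfeas, fun i => ?_⟩
    rw [hLu]
    calc ∑ r, |(u r + t • d r) i - y r i| ≤ ∑ r, (|u r i - y r i| + t * |d r i|) := by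
          refine Finset.sum_le_sum fun r _ => ?_
          have : (u r + t • d r) i - y r i = (u r i - y r i) + t * d r i := by
            simp; ring
          rw [this]
          refine (abs_add_le _ _).trans ?_
          rw [abs_mul, abs_of_pos ht]
      _ = ∑ r, |u r i - y r i| + t * ∑ r, |d r i| := by
          rw [Finset.sum_add_distrib, Finset.mul_sum]
      _ ≤ L y - (L u - 2 * t) := by
          have := hu.2 i
          have := mul_le_mul_of_nonneg_left (hd i) ht.le
          linarith
  have := hmin hmem
  simp only [Set.mem_ofPred_eq, hLu] at this
  linarith

end Exchange

/-! ### Bounds on base polytopes, the cones over them, and attainment of minima. -/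

section Cone

variable {N R : ℕ}

/-- The largest value of `F ^ 2`. -/
noncomputable def maxSq (F : Finset (Fin N) → ℝ) : ℝ := ⨆ S : Finset (Fin N), F S ^ 2

lemma sq_le_maxSq (F : Finset (Fin N) → ℝ) (S : Finset (Fin N)) : F S ^ 2 ≤ maxSq F :=
  le_ciSup (f := fun S => F S ^ 2) (Set.finite_range _).bddAbove S

lemma maxSq_nonneg (F : Finset (Fin N) → ℝ) : 0 ≤ maxSq F :=
  (sq_nonneg _).trans (sq_le_maxSq F ∅)

lemma le_sqrt_maxSq (F : Finset (Fin N) → ℝ) (S : Finset (Fin N)) : F S ≤ √(maxSq F) :=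
  Real.le_sqrt_of_sq_le (sq_le_maxSq F S)

variable {F : Finset (Fin N) → ℝ}

/-- The upper bound on `b i` is the constraint on `{i}`; the lower one follows from the constraint
on the complement of `{i}` and `0 ≤ F univ`. -/
lemma sq_le_maxSq_of_mem (hF : IsAdmissible F) {b : Fin N → ℝ} (hb : b ∈ basePolytope F)
    (i : Fin N) : b i ^ 2 ≤ maxSq F := by
  have h1 : b i ≤ √(maxSq F) := by
    have := hb.1 {i}
    rw [Finset.sum_singleton] at this
    exact this.trans (le_sqrt_maxSq F _)
  have h2 : -√(maxSq F) ≤ b i := by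
    have h3 := hb.1 (Finset.univ.erase i)
    have h4 := Finset.add_sum_erase Finset.univ b (Finset.mem_univ i)
    have h5 := le_sqrt_maxSq F (Finset.univ.erase i)
    have h6 := hF.nonneg Finset.univ
    have h7 := hb.2
    linarith
  have := sq_le_sq' h2 h1
  rwa [Real.sq_sqrt (maxSq_nonneg F)] at this

/-- The `ℓ¹`-norm is twice the sum of the nonnegative entries, itself bounded by one value of `F`,
minus the total, which is nonnegative. No factor `N` is lost. -/
lemma sum_abs_le_of_mem (hF : IsAdmissible F) {b : Fin N → ℝ} (hb : b ∈ basePolytope F) :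
    ∑ i, |b i| ≤ 2 * √(maxSq F) := by
  classical
  have h1 : ∑ i, |b i| = 2 * ∑ i ∈ Finset.univ.filter (fun i => 0 ≤ b i), b i - ∑ i, b i := by
    rw [Finset.sum_filter, Finset.mul_sum, ← Finset.sum_sub_distrib]
    refine Finset.sum_congr rfl fun i _ => ?_
    split_ifs with h
    · rw [abs_of_nonneg h]; ring
    · rw [abs_of_neg (not_le.1 h)]; ring
  have h2 := (hb.1 (Finset.univ.filter fun i => 0 ≤ b i)).trans (le_sqrt_maxSq F _)
  have h3 := hF.nonneg Finset.univ
  have h4 := hb.2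
  linarith

lemma eq_zero_of_notMem_incidentSet (hF : IsAdmissible F) {b : Fin N → ℝ}
    (hb : b ∈ basePolytope F) {i : Fin N} (hi : i ∉ incidentSet F) : b i = 0 := by
  have hi' : ∀ S, F S = F (insert i S) := by
    intro S
    by_contra h
    exact hi ⟨S, h⟩
  have h1 := hb.1 {i}
  have h2 := hi' ∅
  have h3 := hi' (Finset.univ.erase i)
  have h4 := hb.1 (Finset.univ.erase i)
  have h5 := Finset.add_sum_erase Finset.univ b (Finset.mem_univ i)
  have h6 := hb.2
  rw [Finset.insert_erase (Finset.mem_univ i)] at h3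
  simp only [insert_empty_eq, hF.normalized] at h2
  rw [Finset.sum_singleton] at h1
  linarith

lemma maxSq_eq_zero (hF : IsAdmissible F) (h : ∀ i, i ∉ incidentSet F) : maxSq F = 0 := by
  have h0 : ∀ S, F S = 0 := by
    intro S
    induction S using Finset.induction_on with
    | empty => exact hF.normalized
    | insert i S _ ih =>
      by_contra hne
      exact h i ⟨S, fun he => hne (he ▸ ih)⟩
  simp [maxSq, h0]

lemma maxSq_pos {i : Fin N} (hi : i ∈ incidentSet F) : 0 < maxSq F := by
  obtain ⟨S, hS⟩ := hi
  by_contra h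
  have h0 : ∀ T, F T = 0 := fun T => by
    have := sq_le_maxSq F T
    exact pow_eq_zero_iff two_ne_zero |>.1 (le_antisymm (this.trans (not_lt.1 h)) (sq_nonneg _))
  exact hS (by rw [h0, h0])

lemma maxSq_le_degree (F : Fin R → Finset (Fin N) → ℝ) {i : Fin N} {r : Fin R}
    (hi : i ∈ incidentSet (F r)) : maxSq (F r) ≤ degree F i := by
  classical
  have := Finset.single_le_sum (f := fun r => if i ∈ incidentSet (F r) then maxSq (F r) else 0)
    (fun r _ => by split_ifs; exacts [maxSq_nonneg _, le_rfl]) (Finset.mem_univ r)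
  simp only [hi, if_true] at this
  refine this.trans (le_of_eq ?_)
  unfold degree maxSq
  exact Finset.sum_congr rfl fun r _ => by congr

lemma degree_pos (F : Fin R → Finset (Fin N) → ℝ) {i : Fin N}
    (h : ∃ r, i ∈ incidentSet (F r)) : 0 < degree F i := by
  obtain ⟨r, hr⟩ := h
  exact (maxSq_pos hr).trans_le (maxSq_le_degree F hr)

/-- Each `r` with an incident element is counted in at least one degree; a function without incident
elements vanishes. -/
lemma sum_maxSq_le {F : Fin R → Finset (Fin N) → ℝ} (hF : ∀ r, IsAdmissible (F r)) :
    ∑ r, maxSq (F r) ≤ ∑ i, degree F i := by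
  classical
  have : ∑ i, degree F i = ∑ r, ∑ i, if i ∈ incidentSet (F r) then maxSq (F r) else 0 := by
    rw [Finset.sum_comm]
    refine Finset.sum_congr rfl fun i _ => ?_
    unfold degree maxSq
    exact Finset.sum_congr rfl fun r _ => by congr
  rw [this]
  refine Finset.sum_le_sum fun r _ => ?_
  have h0 : ∀ i, 0 ≤ if i ∈ incidentSet (F r) then maxSq (F r) else 0 := fun i => by
    split_ifs; exacts [maxSq_nonneg _, le_rfl]
  by_cases h : ∃ i, i ∈ incidentSet (F r)
  · obtain ⟨i, hi⟩ := h
    have := Finset.single_le_sum (f := fun i => if i ∈ incidentSet (F r) then maxSq (F r) else 0)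
      (fun i _ => h0 i) (Finset.mem_univ i)
    simpa only [hi, if_true] using this
  · rw [maxSq_eq_zero (hF r) (not_exists.1 h)]
    simp

/-- This describes the cone by linear constraints and lets the exchange results act on `φ F`. At `φ
= 0` those constraints force `y = 0`, which lies in `0 • basePolytope F` only if the polytope is
nonempty. -/
lemma mem_cone_iff (hB : (basePolytope F).Nonempty) (p : (Fin N → ℝ) × ℝ) :
    p ∈ cone F ↔ 0 ≤ p.2 ∧ p.1 ∈ basePolytope (p.2 • F) := by
  refine and_congr_right fun hp => ⟨?_, fun h => ?_⟩
  · rintro ⟨b, hb, hbp⟩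
    rw [← hbp]
    refine ⟨fun S => ?_, ?_⟩
    · simpa [← Finset.mul_sum] using mul_le_mul_of_nonneg_left (hb.1 S) hp
    · simp [← Finset.mul_sum, hb.2]
  · rcases hp.eq_or_lt with h0 | hpos
    · have hle : ∀ i, p.1 i ≤ 0 := fun i => by simpa [← h0] using h.1 {i}
      have hsum : ∑ i, p.1 i = 0 := by simpa [← h0] using h.2
      have : p.1 = 0 := by
        ext i
        exact (Finset.sum_eq_zero_iff_of_nonpos fun i _ => hle i).1 hsum i (Finset.mem_univ i)
      obtain ⟨b, hb⟩ := hB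
      exact ⟨b, hb, by simp [← h0, this]⟩
    · refine ⟨p.2⁻¹ • p.1, ⟨fun S => ?_, ?_⟩, by simp [smul_smul, hpos.ne']⟩
      · have := h.1 S
        simp only [Pi.smul_apply, smul_eq_mul, ← Finset.mul_sum] at this ⊢
        rwa [inv_mul_le_iff₀ hpos]
      · have := h.2
        simp only [Pi.smul_apply, smul_eq_mul, ← Finset.mul_sum] at this ⊢
        rw [this, inv_mul_cancel_left₀ hpos.ne']

lemma IsAdmissible.smul (hF : IsAdmissible F) {c : ℝ} (hc : 0 ≤ c) : IsAdmissible (c • F) where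
  submodular S T := by
    simpa [← mul_add] using mul_le_mul_of_nonneg_left (hF.submodular S T) hc
  normalized := by simp [hF.normalized]
  nonneg S := mul_nonneg hc (hF.nonneg S)

lemma convex_cone (hB : (basePolytope F).Nonempty) : Convex ℝ (cone F) := by
  intro p hp q hq s t hs ht _
  rw [mem_cone_iff hB] at hp hq ⊢
  refine ⟨?_, fun S => ?_, ?_⟩
  · have := mul_nonneg hs hp.1
    have := mul_nonneg ht hq.1
    simp; positivity
  · have h1 := mul_le_mul_of_nonneg_left (hp.2.1 S) hs
    have h2 := mul_le_mul_of_nonneg_left (hq.2.1 S) ht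
    simp [Finset.sum_add_distrib, ← Finset.mul_sum] at h1 h2 ⊢
    linarith
  · have h1 := hp.2.2
    have h2 := hq.2.2
    simp [Finset.sum_add_distrib, ← Finset.mul_sum] at h1 h2 ⊢
    rw [h1, h2]; ring

lemma isClosed_cone (hB : (basePolytope F).Nonempty) : IsClosed (cone F) := by
  have : cone F = {p | 0 ≤ p.2} ∩ ((⋂ S : Finset (Fin N), {p | ∑ i ∈ S, p.1 i ≤ p.2 * F S}) ∩
      {p | ∑ i, p.1 i = p.2 * F Finset.univ}) := by
    ext p
    rw [mem_cone_iff hB]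
    simp [basePolytope]
  rw [this]
  refine (isClosed_le (by fun_prop) (by fun_prop)).inter
    ((isClosed_iInter fun S => isClosed_le (by fun_prop) (by fun_prop)).inter
      (isClosed_eq (by fun_prop) (by fun_prop)))

lemma zero_mem_cone (hB : (basePolytope F).Nonempty) : (0 : (Fin N → ℝ) × ℝ) ∈ cone F := by
  obtain ⟨b, hb⟩ := hB
  exact ⟨le_rfl, b, hb, by simp⟩

lemma nonempty_of_mem_cone {p : (Fin N → ℝ) × ℝ} (hp : p ∈ cone F) :
    (basePolytope F).Nonempty := by
  obtain ⟨_, b, hb, _⟩ := hp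
  exact ⟨b, hb⟩

lemma abs_le_of_mem_cone (hF : IsAdmissible F) {p : (Fin N → ℝ) × ℝ} (hp : p ∈ cone F)
    (i : Fin N) : |p.1 i| ≤ p.2 * √(maxSq F) := by
  obtain ⟨h0, b, hb, hbp⟩ := hp
  rw [← hbp]
  simp only [Pi.smul_apply, smul_eq_mul, abs_mul, abs_of_nonneg h0]
  exact mul_le_mul_of_nonneg_left (Real.abs_le_sqrt (sq_le_maxSq_of_mem hF hb i)) h0

/-- Continuous functions that grow like `φ` on the product of the cones attain their minimum. -/
lemma exists_isMinOn_feasible {F : Fin R → Finset (Fin N) → ℝ} (hF : ∀ r, IsAdmissible (F r))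
    (hB : ∀ r, (basePolytope (F r)).Nonempty) {h : (Fin R → (Fin N → ℝ) × ℝ) → ℝ}
    (hc : Continuous h) (hh : ∀ z, ∑ r, (z r).2 ^ 2 ≤ h z) :
    ∃ z ∈ feasible F, IsMinOn h (feasible F) z := by
  set K : Set (Fin R → (Fin N → ℝ) × ℝ) := feasible F ∩ {z | h z ≤ h 0}
  have h00 : 0 ≤ h 0 := le_trans (by simp) (hh 0)
  have hcl : IsClosed K := by
    refine IsClosed.inter ?_ (isClosed_le hc continuous_const)
    have : feasible F = ⋂ r, (fun z : Fin R → (Fin N → ℝ) × ℝ => z r) ⁻¹' cone (F r) := by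
      ext z; simp [feasible]
    rw [this]
    exact isClosed_iInter fun r => (isClosed_cone (hB r)).preimage (continuous_apply r)
  -- On the sublevel set `φ_r ≤ φ_r² + 1 ≤ h 0 + 1`, and `φ_r` in turn bounds `y_r`.
  have hsub : K ⊆ Set.Icc (fun r => (fun _ => -((h 0 + 1) * √(maxSq (F r))), 0))
      (fun r => (fun _ => (h 0 + 1) * √(maxSq (F r)), h 0 + 1)) := by
    rintro z ⟨hz, hz0⟩
    have h1 : ∀ r, (z r).2 ≤ h 0 + 1 := by
      intro r
      have := (Finset.single_le_sum (f := fun r => (z r).2 ^ 2) (fun _ _ => sq_nonneg _)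
        (Finset.mem_univ r)).trans ((hh z).trans hz0)
      nlinarith
    have h2 : ∀ r i, |(z r).1 i| ≤ (h 0 + 1) * √(maxSq (F r)) := fun r i =>
      (abs_le_of_mem_cone (hF r) (hz r) i).trans
        (mul_le_mul_of_nonneg_right (h1 r) (Real.sqrt_nonneg _))
    exact ⟨fun r => ⟨fun i => (abs_le.1 (h2 r i)).1, (hz r).1⟩,
      fun r => ⟨fun i => (abs_le.1 (h2 r i)).2, h1 r⟩⟩
  have hK : IsCompact K := isCompact_Icc.of_isClosed_subset hcl hsub
  obtain ⟨z, hz, hmin⟩ := hK.exists_isMinOn ⟨0, fun r => zero_mem_cone (hB r), le_refl (h 0)⟩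
    hc.continuousOn
  refine ⟨z, hz.1, fun w hw => ?_⟩
  by_cases hw0 : h w ≤ h 0
  · exact hmin ⟨hw, hw0⟩
  · exact (show h z ≤ h 0 from hz.2).trans (not_le.1 hw0).le

lemma wnormSq_nonneg {w : Fin N → ℝ} (hw : ∀ i, 0 ≤ w i) (x : Fin N → ℝ) : 0 ≤ wnormSq w x :=
  Finset.sum_nonneg fun i _ => mul_nonneg (hw i) (sq_nonneg _)

lemma continuous_wnormSq (w : Fin N → ℝ) : Continuous (wnormSq w) := by
  unfold wnormSq; fun_prop

lemma coneProj_spec (hF : IsAdmissible F) (hB : (basePolytope F).Nonempty) {W : Fin N → ℝ}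
    (hW : ∀ i, 0 < W i) (b : Fin N → ℝ) :
    coneProj W F b ∈ cone F ∧
      IsMinOn (fun q : (Fin N → ℝ) × ℝ => wnormSq W⁻¹ (q.1 - b) + q.2 ^ 2) (cone F)
        (coneProj W F b) := by
  refine Classical.epsilon_spec (p := fun p => p ∈ cone F ∧
    IsMinOn (fun q : (Fin N → ℝ) × ℝ => wnormSq W⁻¹ (q.1 - b) + q.2 ^ 2) (cone F) p) ?_
  obtain ⟨z, hz, hmin⟩ := exists_isMinOn_feasible (R := 1) (F := fun _ => F) (fun _ => hF)
    (fun _ => hB) (h := fun z => wnormSq W⁻¹ ((z 0).1 - b) + (z 0).2 ^ 2)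
    (by have := continuous_wnormSq W⁻¹; fun_prop)
    (fun z => by
      have := wnormSq_nonneg (w := W⁻¹) (fun i => (inv_pos.2 (hW i)).le) ((z 0).1 - b)
      simp; exact this)
  exact ⟨z 0, hz 0, fun q hq => hmin (show (fun _ => q) ∈ feasible fun _ => F from fun _ => hq)⟩

/-- Quadratic growth of a convex quadratic function from its minimizer. -/
lemma add_le_of_isMinOn {E : Type*} [AddCommGroup E] [Module ℝ E] {S : Set E} (hS : Convex ℝ S)
    {f : E → ℝ} {z w : E} (hz : z ∈ S) (hw : w ∈ S) (hmin : IsMinOn f S z) {l q : ℝ}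
    (hf : ∀ t : ℝ, f (z + t • (w - z)) = f z + t * l + t ^ 2 * q) : f z + q ≤ f w := by
  have hl : ∀ t : ℝ, 0 < t → t ≤ 1 → 0 ≤ l + t * q := by
    intro t h0 h1
    have := hmin (hS.add_smul_sub_mem hz hw ⟨h0.le, h1⟩)
    simp only [Set.mem_ofPred_eq, hf] at this
    by_contra hneg
    nlinarith
  -- First-order optimality: a negative slope is contradicted by a step small enough that `t * q ≤
  -- -l / 2`.
  have h0 : 0 ≤ l := by
    by_contra hneg
    push Not at hneg
    have hq : 0 < q := by have := hl 1 one_pos le_rfl; linarith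
    have := hl (min 1 (-l / (2 * q))) (lt_min one_pos (by apply div_pos <;> linarith))
      (min_le_left _ _)
    have h2 : min 1 (-l / (2 * q)) * q ≤ -l / (2 * q) * q :=
      mul_le_mul_of_nonneg_right (min_le_right _ _) hq.le
    have h3 : -l / (2 * q) * q = -l / 2 := by field_simp
    linarith
  have := hf 1
  simp only [one_smul, add_sub_cancel] at this
  rw [this]; linarith

end Cone

/-! ### The error bound: distance to a prescribed sum and multipliers versus aggregate deviation. -/

section ErrorBound

variable {N R : ℕ}

/-- The squared norm of a family of dual variables. -/
noncomputable def sqNorm (W : Fin N → ℝ) (z : Fin R → (Fin N → ℝ) × ℝ) : ℝ :=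
  ∑ r, (wnormSq W⁻¹ (z r).1 + (z r).2 ^ 2)

/-- The quadratic part of the dual objective. -/
noncomputable def aggSq (W : Fin N → ℝ) (z : Fin R → (Fin N → ℝ) × ℝ) : ℝ :=
  wnormSq W⁻¹ (∑ r, (z r).1) + ∑ r, (z r).2 ^ 2

/-- The largest ratio of two entries of `D`. -/
noncomputable def maxRatio (D : Fin N → ℝ) : ℝ := ⨆ p : Fin N × Fin N, D p.1 / D p.2

lemma div_le_maxRatio (D : Fin N → ℝ) (i j : Fin N) : D i / D j ≤ maxRatio D :=
  le_ciSup (f := fun p : Fin N × Fin N => D p.1 / D p.2) (Set.finite_range _).bddAbove (i, j)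

lemma one_le_maxRatio {D : Fin N → ℝ} (hD : ∀ i, 0 < D i) (hN : 0 < N) : 1 ≤ maxRatio D := by
  have := div_le_maxRatio D ⟨0, hN⟩ ⟨0, hN⟩
  rwa [div_self (hD _).ne'] at this

/-- Expanding the product gives `N²` ratios; this is where the factor `N² max (D_ii/D_jj)` arises.
-/
lemma sum_inv_mul_sum_le (D : Fin N → ℝ) :
    (∑ i, (D i)⁻¹) * ∑ j, D j ≤ (N : ℝ) ^ 2 * maxRatio D := by
  rw [Finset.sum_mul_sum]
  calc ∑ i, ∑ j, (D i)⁻¹ * D j ≤ ∑ i : Fin N, ∑ j : Fin N, maxRatio D :=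
        Finset.sum_le_sum fun i _ => Finset.sum_le_sum fun j _ => by
          rw [inv_mul_eq_div]; exact div_le_maxRatio D j i
    _ = (N : ℝ) ^ 2 * maxRatio D := by simp; ring

lemma sq_sum_abs_le {W : Fin N → ℝ} (hW : ∀ i, 0 < W i) (x : Fin N → ℝ) :
    (∑ i, |x i|) ^ 2 ≤ (∑ i, W i) * wnormSq W⁻¹ x := by
  refine Finset.sum_sq_le_sum_mul_sum_of_sq_le_mul _ (fun i _ => (hW i).le)
    (fun i _ => mul_nonneg (inv_pos.2 (hW i)).le (sq_nonneg _)) fun i _ => le_of_eq ?_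
  have := (hW i).ne'
  simp only [Pi.inv_apply, sq_abs]
  field_simp

/-- Changing the multipliers of the base polytopes: every feasible point can be moved to one with
the multipliers and the sum of a second feasible point, at a cost bounded by the difference of
the multipliers and the sums. -/
theorem exists_feasible_sum_eq {F : Fin R → Finset (Fin N) → ℝ} (hF : ∀ r, IsAdmissible (F r))
    {z z' : Fin R → (Fin N → ℝ) × ℝ} (hz : z ∈ feasible F) (hz' : z' ∈ feasible F) :
    ∃ (b y : Fin R → Fin N → ℝ) (l : ℝ), (∀ r, b r ∈ basePolytope (F r)) ∧
      (∀ r, (z r).1 = (z r).2 • b r) ∧ (∀ r, (y r, (z' r).2) ∈ cone (F r)) ∧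
      ∑ r, y r = ∑ r, (z' r).1 ∧ 0 ≤ l ∧ (∀ i, ∑ r, |y r i - (z' r).2 * b r i| ≤ l) ∧
      l ≤ ∑ j, |∑ r, (z r).1 j - ∑ r, (z' r).1 j| +
        ∑ r, |(z r).2 - (z' r).2| * (2 * √(maxSq (F r))) := by
  have hB : ∀ r, (basePolytope (F r)).Nonempty := fun r => nonempty_of_mem_cone (hz r)
  have hz₂ := fun r => (hz r).2
  choose b hb hbz using hz₂
  simp only at hbz
  -- First rescale each `φ_r b_r` to `φ'_r b_r`, then redistribute inside the polytopes of `φ'_r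
  -- F_r`. The rescaling adds the multiplier term to the bound on the `ℓ¹`-distance of the sums.
  have hb' : ∀ r, (z' r).2 • b r ∈ basePolytope ((z' r).2 • F r) := fun r =>
    ((mem_cone_iff (hB r) ((z' r).2 • b r, (z' r).2)).1 ⟨(hz' r).1, b r, hb r, rfl⟩).2
  obtain ⟨y, hy, hsum, hdist⟩ := exists_redistribution (fun r => (hF r).smul (hz' r).1) hb'
    fun r => ((mem_cone_iff (hB r) _).1 (hz' r)).2
  refine ⟨b, y, _, hb, fun r => (hbz r).symm, fun r => (mem_cone_iff (hB r) _).2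
    ⟨(hz' r).1, hy r⟩, hsum, Finset.sum_nonneg fun _ _ => abs_nonneg _, hdist, ?_⟩
  calc ∑ j, |∑ r, ((z' r).2 • b r) j - ∑ r, (z' r).1 j|
      ≤ ∑ j, (|∑ r, (z r).1 j - ∑ r, (z' r).1 j| + ∑ r, |(z r).2 - (z' r).2| * |b r j|) := by
        refine Finset.sum_le_sum fun j _ => ?_
        have : ∑ r, ((z' r).2 • b r) j - ∑ r, (z' r).1 j =
            (∑ r, (z r).1 j - ∑ r, (z' r).1 j) - ∑ r, ((z r).2 - (z' r).2) * b r j := by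
          simp only [← hbz, Pi.smul_apply, smul_eq_mul, sub_mul, Finset.sum_sub_distrib]
          ring
        rw [this]
        refine (abs_sub _ _).trans (add_le_add_right ?_ _)
        refine (Finset.abs_sum_le_sum_abs _ _).trans (le_of_eq ?_)
        simp only [abs_mul]
    _ ≤ _ := by
        rw [Finset.sum_add_distrib, Finset.sum_comm (f := fun j r => |(z r).2 - (z' r).2| * |b r j|)]
        refine add_le_add_right (Finset.sum_le_sum fun r _ => ?_) _
        rw [← Finset.mul_sum]
        exact mul_le_mul_of_nonneg_left (sum_abs_le_of_mem (hF r) (hb r)) (abs_nonneg _)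

/-- The error bound: up to the conditioning factor, the distance of a feasible point to the
feasible points with prescribed sum and multipliers is controlled by the deviation of its own sum
and multipliers. -/
theorem exists_sqNorm_sub_le {F : Fin R → Finset (Fin N) → ℝ} (hF : ∀ r, IsAdmissible (F r))
    (hD : ∀ i, 0 < degree F i) {β : ℝ} (hβ : 0 < β) (hN : 0 < N) {W : Fin N → ℝ}
    (hW : W = β • degree F)
    {z z' : Fin R → (Fin N → ℝ) × ℝ} (hz : z ∈ feasible F) (hz' : z' ∈ feasible F) :
    ∃ z'' ∈ feasible F, ∑ r, (z'' r).1 = ∑ r, (z' r).1 ∧ (∀ r, (z'' r).2 = (z' r).2) ∧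
      sqNorm W (z - z'') ≤
        4 * ((N : ℝ) ^ 2 * max 1 (9 * β⁻¹) * maxRatio (degree F)) * aggSq W (z - z') := by
  obtain ⟨b, y, l, hb, hbz, hy, hsum, hl0, hl, hle⟩ := exists_feasible_sum_eq hF hz hz'
  refine ⟨fun r => (y r, (z' r).2), hy, hsum, fun _ => rfl, ?_⟩
  have hWpos : ∀ i, 0 < W i := fun i => by rw [hW]; exact mul_pos hβ (hD i)
  set X := ∑ r, ((z r).2 - (z' r).2) ^ 2 with hX
  set Y := wnormSq W⁻¹ (∑ r, (z r).1 - ∑ r, (z' r).1) with hY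
  have hX0 : 0 ≤ X := Finset.sum_nonneg fun _ _ => sq_nonneg _
  have hY0 : 0 ≤ Y := wnormSq_nonneg (fun i => (inv_pos.2 (hWpos i)).le) _
  set κ := (N : ℝ) ^ 2 * maxRatio (degree F) with hκ
  have hNκ : (N : ℝ) ≤ κ := by
    have h1 : (1 : ℝ) ≤ N := by exact_mod_cast hN
    have h2 := one_le_maxRatio hD hN
    nlinarith
  have hκ0 : 0 ≤ κ := (Nat.cast_nonneg N).trans hNκ
  have hagg : aggSq W (z - z') = Y + X := by
    simp [aggSq, hX, hY]
  have hsq : sqNorm W (z - fun r => (y r, (z' r).2)) =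
      ∑ i, ∑ r, (W i)⁻¹ * ((z r).1 i - y r i) ^ 2 + X := by
    rw [Finset.sum_comm]
    simp [sqNorm, Finset.sum_add_distrib, wnormSq, hX]
  -- The difference splits into a rescaling part `Δ * b r i` and a redistribution part `e`. The
  -- weights `D_ii` make `b r i ^ 2 / W i` at most `1 / β`. Keeping `l * |e|` instead of `l ^ 2`
  -- makes the later sum over `r` free of a factor `R`.
  have hpt : ∀ i r, (W i)⁻¹ * ((z r).1 i - y r i) ^ 2 ≤
      2 * β⁻¹ * ((z r).2 - (z' r).2) ^ 2 +
        2 * (W i)⁻¹ * (l * |y r i - (z' r).2 * b r i|) := by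
    intro i r
    have hWi := inv_pos.2 (hWpos i)
    have h1 : (W i)⁻¹ * b r i ^ 2 ≤ β⁻¹ := by
      by_cases hi : i ∈ incidentSet (F r)
      · have h2 := (sq_le_maxSq_of_mem (hF r) (hb r) i).trans (maxSq_le_degree F hi)
        rw [inv_mul_le_iff₀ (hWpos i), hW]
        simp only [Pi.smul_apply, smul_eq_mul]
        rwa [mul_comm β, mul_inv_cancel_right₀ hβ.ne']
      · rw [eq_zero_of_notMem_incidentSet (hF r) (hb r) hi]
        simpa using hβ.le
    have h2 : (y r i - (z' r).2 * b r i) ^ 2 ≤ l * |y r i - (z' r).2 * b r i| := by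
      rw [← sq_abs, sq]
      refine mul_le_mul_of_nonneg_right ?_ (abs_nonneg _)
      exact (Finset.single_le_sum (f := fun r => |y r i - (z' r).2 * b r i|)
        (fun _ _ => abs_nonneg _) (Finset.mem_univ r)).trans (hl i)
    have h3 : (z r).1 i = (z r).2 * b r i := by rw [hbz]; rfl
    rw [h3]
    set e := y r i - (z' r).2 * b r i
    set Δ := (z r).2 - (z' r).2
    have h4 : (z r).2 * b r i - y r i = Δ * b r i - e := by simp only [Δ, e]; ring
    rw [h4]
    have h5 : (Δ * b r i - e) ^ 2 ≤ 2 * (Δ ^ 2 * b r i ^ 2) + 2 * (l * |e|) := by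
      nlinarith [sq_nonneg (Δ * b r i + e)]
    have h6 := mul_le_mul_of_nonneg_left h5 hWi.le
    have h7 := mul_le_mul_of_nonneg_left h1 (sq_nonneg Δ)
    linarith
  have hrow : ∀ i, ∑ r, (W i)⁻¹ * ((z r).1 i - y r i) ^ 2 ≤
      2 * β⁻¹ * X + 2 * (W i)⁻¹ * l ^ 2 := by
    intro i
    refine (Finset.sum_le_sum fun r _ => hpt i r).trans ?_
    rw [Finset.sum_add_distrib, ← Finset.mul_sum, ← Finset.mul_sum, ← Finset.mul_sum, sq l]
    have := inv_pos.2 (hWpos i)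
    have := hl i
    gcongr
  have hall : ∑ i, ∑ r, (W i)⁻¹ * ((z r).1 i - y r i) ^ 2 ≤
      N * (2 * β⁻¹ * X) + 2 * ((∑ i, (W i)⁻¹) * l ^ 2) := by
    refine (Finset.sum_le_sum fun i _ => hrow i).trans (le_of_eq ?_)
    rw [Finset.sum_add_distrib, Finset.sum_mul, Finset.mul_sum]
    simp [mul_assoc, Finset.mul_sum]
  -- Cauchy–Schwarz is applied separately to the deviation of the sums and to that of the
  -- multipliers.
  have hl2 : l ^ 2 ≤ 2 * ((∑ i, W i) * Y) + 2 * (X * (4 * ∑ i, degree F i)) := by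
    have hA := sq_sum_abs_le hWpos (∑ r, (z r).1 - ∑ r, (z' r).1)
    have hB : (∑ r, |(z r).2 - (z' r).2| * (2 * √(maxSq (F r)))) ^ 2 ≤
        X * ∑ r, 4 * maxSq (F r) := by
      refine Finset.sum_sq_le_sum_mul_sum_of_sq_le_mul _ (fun _ _ => sq_nonneg _)
        (fun r _ => mul_nonneg (by norm_num) (maxSq_nonneg _)) fun r _ => le_of_eq ?_
      rw [mul_pow, mul_pow, sq_abs, Real.sq_sqrt (maxSq_nonneg _)]
      norm_num
    rw [← Finset.mul_sum] at hB
    have hB' := hB.trans (mul_le_mul_of_nonneg_left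
      (mul_le_mul_of_nonneg_left (sum_maxSq_le hF) (by norm_num : (0 : ℝ) ≤ 4)) hX0)
    simp only [Pi.sub_apply, Finset.sum_apply] at hA
    have h1 := pow_le_pow_left₀ hl0 hle 2
    have h2 := add_sq_le (a := ∑ j, |∑ r, (z r).1 j - ∑ r, (z' r).1 j|)
      (b := ∑ r, |(z r).2 - (z' r).2| * (2 * √(maxSq (F r))))
    linarith
  have hratio := sum_inv_mul_sum_le (degree F)
  have hV : ∑ i, (W i)⁻¹ = β⁻¹ * ∑ i, (degree F i)⁻¹ := by
    rw [hW, Finset.mul_sum]; simp [mul_comm]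
  have hWs : ∑ i, W i = β * ∑ i, degree F i := by
    rw [hW, Finset.mul_sum]; simp
  have hVW : (∑ i, (W i)⁻¹) * ∑ i, W i ≤ κ := by
    rw [hV, hWs]
    refine le_trans (le_of_eq ?_) hratio
    field_simp
  have hVD : (∑ i, (W i)⁻¹) * ∑ i, degree F i ≤ β⁻¹ * κ := by
    rw [hV, mul_assoc]
    exact mul_le_mul_of_nonneg_left hratio (inv_pos.2 hβ).le
  have hV0 : 0 ≤ ∑ i, (W i)⁻¹ := Finset.sum_nonneg fun i _ => (inv_pos.2 (hWpos i)).le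
  have hVl : (∑ i, (W i)⁻¹) * l ^ 2 ≤ 2 * (κ * Y) + 8 * (β⁻¹ * κ * X) := by
    have h1 := mul_le_mul_of_nonneg_left hl2 hV0
    have h2 := mul_le_mul_of_nonneg_right hVW hY0
    have h3 := mul_le_mul_of_nonneg_right hVD hX0
    linarith
  rw [hsq, hagg]
  -- The total is at most `4 κ Y + (16 κ + 2 N) β⁻¹ X + X`. Since `N ≤ κ`, the middle coefficient is
  -- at most `18 κ β⁻¹ ≤ 2 m κ`, so `X` gets at most `3 m κ`, within the claimed factor `4`.
  set m := max 1 (9 * β⁻¹)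
  have hm1 : 1 ≤ m := le_max_left _ _
  have hm2 : 9 * β⁻¹ ≤ m := le_max_right _ _
  have hκm : (N : ℝ) ^ 2 * m * maxRatio (degree F) = m * κ := by rw [hκ]; ring
  rw [hκm]
  have hN1 : (1 : ℝ) ≤ N := by exact_mod_cast hN
  have e1 : κ * Y ≤ m * κ * Y := by
    have := mul_nonneg hκ0 hY0; nlinarith
  have e2 : β⁻¹ * κ * X ≤ m * κ * X / 9 := by
    have := mul_le_mul_of_nonneg_right hm2 (mul_nonneg hκ0 hX0); linarith
  have e3 : N * (β⁻¹ * X) ≤ m * κ * X / 9 := by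
    have := mul_le_mul_of_nonneg_right hNκ (mul_nonneg (inv_pos.2 hβ).le hX0); linarith
  have e4 : X ≤ m * κ * X := by
    have h1 : 1 ≤ m * κ := by nlinarith
    nlinarith
  linarith

end ErrorBound

/-! ### Block minimization, quadratic growth and one-step contraction. -/

section Descent

variable {N R : ℕ}

/-- The squared norm on one component of the dual variable. -/
noncomputable def blockSq (W : Fin N → ℝ) (v : (Fin N → ℝ) × ℝ) : ℝ :=
  wnormSq W⁻¹ v.1 + v.2 ^ 2

/-- The partial derivative of the dual objective in the direction `v` of the component `r`. -/
noncomputable def partialGrad (W a : Fin N → ℝ) (z : Fin R → (Fin N → ℝ) × ℝ) (r : Fin R)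
    (v : (Fin N → ℝ) × ℝ) : ℝ :=
  2 * ∑ i, (W i)⁻¹ * (∑ r', (z r').1 i - 2 * (W i * a i)) * v.1 i + 2 * ((z r).2 * v.2)

lemma sqNorm_eq (W : Fin N → ℝ) (z : Fin R → (Fin N → ℝ) × ℝ) :
    sqNorm W z = ∑ r, blockSq W (z r) := rfl

lemma distSqSolutions_eq (F : Fin R → Finset (Fin N) → ℝ) (W a : Fin N → ℝ)
    (z : Fin R → (Fin N → ℝ) × ℝ) :
    distSqSolutions F W a z = ⨅ z' : dualSolutions F W a, sqNorm W (z - z'.1) := rfl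

lemma blockSq_nonneg {W : Fin N → ℝ} (hW : ∀ i, 0 < W i) (v : (Fin N → ℝ) × ℝ) :
    0 ≤ blockSq W v :=
  add_nonneg (wnormSq_nonneg (fun i => (inv_pos.2 (hW i)).le) _) (sq_nonneg _)

lemma sqNorm_nonneg {W : Fin N → ℝ} (hW : ∀ i, 0 < W i) (z : Fin R → (Fin N → ℝ) × ℝ) :
    0 ≤ sqNorm W z :=
  Finset.sum_nonneg fun _ _ => blockSq_nonneg hW _

lemma aggSq_nonneg {W : Fin N → ℝ} (hW : ∀ i, 0 < W i) (z : Fin R → (Fin N → ℝ) × ℝ) :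
    0 ≤ aggSq W z :=
  add_nonneg (wnormSq_nonneg (fun i => (inv_pos.2 (hW i)).le) _)
    (Finset.sum_nonneg fun _ _ => sq_nonneg _)

lemma blockSq_sub_comm (W : Fin N → ℝ) (u v : (Fin N → ℝ) × ℝ) :
    blockSq W (u - v) = blockSq W (v - u) := by
  simp only [blockSq, wnormSq, Prod.fst_sub, Prod.snd_sub, Pi.sub_apply]
  congr 1
  · exact Finset.sum_congr rfl fun i _ => by ring
  · ring

lemma aggSq_sub_comm (W : Fin N → ℝ) (z w : Fin R → (Fin N → ℝ) × ℝ) :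
    aggSq W (z - w) = aggSq W (w - z) := by
  simp only [aggSq, wnormSq, Prod.fst_sub, Prod.snd_sub, Pi.sub_apply, Finset.sum_sub_distrib]
  congr 1
  · exact Finset.sum_congr rfl fun i _ => by ring
  · exact Finset.sum_congr rfl fun i _ => by ring

lemma aggSq_smul (W : Fin N → ℝ) (t : ℝ) (z : Fin R → (Fin N → ℝ) × ℝ) :
    aggSq W (t • z) = t ^ 2 * aggSq W z := by
  simp only [aggSq, wnormSq, Pi.smul_apply, Prod.smul_fst, Prod.smul_snd, smul_eq_mul,
    ← Finset.smul_sum, mul_add, Finset.mul_sum]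
  congr 1
  · exact Finset.sum_congr rfl fun i _ => by ring
  · exact Finset.sum_congr rfl fun i _ => by ring

lemma aggSq_single (W : Fin N → ℝ) (r : Fin R) (v : (Fin N → ℝ) × ℝ) :
    aggSq W (Pi.single r v) = blockSq W v := by
  have h1 : ∑ r', (Pi.single r v : Fin R → (Fin N → ℝ) × ℝ) r' = v := by simp
  have h2 : ∑ r', ((Pi.single r v : Fin R → (Fin N → ℝ) × ℝ) r').1 = v.1 := by
    rw [← Prod.fst_sum, h1]
  have h3 : ∑ r', ((Pi.single r v : Fin R → (Fin N → ℝ) × ℝ) r').2 ^ 2 = v.2 ^ 2 := by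
    rw [Finset.sum_eq_single r] <;> simp +contextual
  rw [aggSq, blockSq, h2, h3]

lemma partialGrad_zero (W a : Fin N → ℝ) (z : Fin R → (Fin N → ℝ) × ℝ) (r : Fin R) :
    partialGrad W a z r 0 = 0 := by
  simp [partialGrad]

lemma partialGrad_smul (W a : Fin N → ℝ) (z : Fin R → (Fin N → ℝ) × ℝ) (r : Fin R) (t : ℝ)
    (v : (Fin N → ℝ) × ℝ) : partialGrad W a z r (t • v) = t * partialGrad W a z r v := by
  simp only [partialGrad, Prod.smul_fst, Prod.smul_snd, Pi.smul_apply, smul_eq_mul, mul_add,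
    Finset.mul_sum]
  congr 1
  · exact Finset.sum_congr rfl fun i _ => by ring
  · ring

lemma dualObj_add (W a : Fin N → ℝ) (z h : Fin R → (Fin N → ℝ) × ℝ) :
    dualObj W a (z + h) = dualObj W a z + ∑ r, partialGrad W a z r (h r) + aggSq W h := by
  have h1 : ∑ r, partialGrad W a z r (h r) =
      ∑ i, 2 * ((W i)⁻¹ * (∑ r', (z r').1 i - 2 * (W i * a i)) * ∑ r, (h r).1 i) +
        ∑ r, 2 * ((z r).2 * (h r).2) := by
    simp only [partialGrad]
    rw [Finset.sum_add_distrib]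
    congr 1
    simp only [Finset.mul_sum]
    rw [Finset.sum_comm]
  rw [h1]
  simp only [dualObj, aggSq, wnormSq, Pi.add_apply, Prod.fst_add, Prod.snd_add,
    Finset.sum_add_distrib, Pi.sub_apply, Finset.sum_apply, Pi.smul_apply, Pi.mul_apply,
    smul_eq_mul, Pi.inv_apply, add_sq]
  have h2 : ∀ i, (W i)⁻¹ * (∑ r, (z r).1 i + ∑ r, (h r).1 i - 2 * (W i * a i)) ^ 2 =
      (W i)⁻¹ * (∑ r, (z r).1 i - 2 * (W i * a i)) ^ 2 +
      2 * ((W i)⁻¹ * (∑ r', (z r').1 i - 2 * (W i * a i)) * ∑ r, (h r).1 i) +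
      (W i)⁻¹ * (∑ r, (h r).1 i) ^ 2 := fun i => by ring
  simp only [h2, Finset.sum_add_distrib, mul_assoc]
  ring

lemma update_eq_add_single (z : Fin R → (Fin N → ℝ) × ℝ) (r : Fin R) (u v : (Fin N → ℝ) × ℝ) :
    Function.update z r v = Function.update z r u + Pi.single r (v - u) := by
  ext1 r'
  rcases eq_or_ne r' r with rfl | h
  · simp
  · simp [h]

/-- On a single block the quadratic part of the objective is exactly the block norm, so restricted
to one block the objective has full quadratic growth. -/
lemma dualObj_update_add (W a : Fin N → ℝ) (z : Fin R → (Fin N → ℝ) × ℝ) (r : Fin R)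
    (u v : (Fin N → ℝ) × ℝ) :
    dualObj W a (Function.update z r v) = dualObj W a (Function.update z r u) +
      partialGrad W a (Function.update z r u) r (v - u) + blockSq W (v - u) := by
  rw [update_eq_add_single z r u v, dualObj_add, aggSq_single]
  congr 2
  rw [Finset.sum_eq_single r]
  · simp
  · intro r' _ h
    rw [Pi.single_eq_of_ne h, partialGrad_zero]
  · simp

lemma dualObj_update (W a : Fin N → ℝ) (z : Fin R → (Fin N → ℝ) × ℝ) (r : Fin R)
    (v : (Fin N → ℝ) × ℝ) :
    dualObj W a (Function.update z r v) =
      wnormSq W⁻¹ (v.1 - ((2 : ℝ) • (W * a) - ∑ r' ∈ Finset.univ.erase r, (z r').1)) + v.2 ^ 2 +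
        ∑ r' ∈ Finset.univ.erase r, (z r').2 ^ 2 := by
  rw [dualObj, ← Finset.add_sum_erase _ _ (Finset.mem_univ r),
    ← Finset.add_sum_erase _ (fun r' => (Function.update z r v r').2 ^ 2) (Finset.mem_univ r),
    Finset.sum_congr (g := fun r' => (z r').1) rfl fun r' hr' => by
      rw [Function.update_of_ne (Finset.ne_of_mem_erase hr')],
    Finset.sum_congr (g := fun r' => (z r').2 ^ 2) rfl fun r' hr' => by
      rw [Function.update_of_ne (Finset.ne_of_mem_erase hr')]]
  simp only [Function.update_self]
  rw [add_assoc]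
  congr 2
  abel

variable {F : Fin R → Finset (Fin N) → ℝ} {W a : Fin N → ℝ} {z : Fin R → (Fin N → ℝ) × ℝ}

/-- Feasibility of the current point supplies the nonemptiness on which closedness of the cones and
existence of minimizers rely. -/
lemma basePolytope_nonempty_of_feasible (hz : z ∈ feasible F) (r : Fin R) :
    (basePolytope (F r)).Nonempty :=
  nonempty_of_mem_cone (hz r)

lemma rcdStep_mem_feasible (hF : ∀ r, IsAdmissible (F r)) (hW : ∀ i, 0 < W i)
    (hz : z ∈ feasible F) (r : Fin R) : rcdStep F W a z r ∈ feasible F := by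
  intro r'
  rcases eq_or_ne r' r with rfl | h
  · simpa [rcdStep] using (coneProj_spec (hF r') (basePolytope_nonempty_of_feasible hz r') hW _).1
  · simpa [rcdStep, h] using hz r'

lemma rcdIter_mem_feasible (hF : ∀ r, IsAdmissible (F r)) (hW : ∀ i, 0 < W i)
    (hz : z ∈ feasible F) (idx : ℕ → Fin R) (k : ℕ) : rcdIter F W a z idx k ∈ feasible F := by
  induction k with
  | zero => exact hz
  | succ k ih => exact rcdStep_mem_feasible hF hW ih _

/-- The decrease of the objective in one iteration. -/
lemma dualObj_rcdStep_add_le (hF : ∀ r, IsAdmissible (F r)) (hW : ∀ i, 0 < W i)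
    (hz : z ∈ feasible F) (r : Fin R) {w : (Fin N → ℝ) × ℝ} (hw : w ∈ cone (F r)) :
    dualObj W a (rcdStep F W a z r) + blockSq W (w - rcdStep F W a z r r) ≤
      dualObj W a z + partialGrad W a z r (w - z r) + blockSq W (w - z r) := by
  have hB := basePolytope_nonempty_of_feasible hz r
  set p := coneProj W (F r) ((2 : ℝ) • (W * a) - ∑ r' ∈ Finset.univ.erase r, (z r').1) with hp
  obtain ⟨hmem, hmin⟩ := coneProj_spec (hF r) hB hW
    ((2 : ℝ) • (W * a) - ∑ r' ∈ Finset.univ.erase r, (z r').1)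
  rw [← hp] at hmem hmin
  have hmin' : IsMinOn (fun v => dualObj W a (Function.update z r v)) (cone (F r)) p := by
    intro v hv
    have := hmin hv
    simp only [Set.mem_ofPred_eq, dualObj_update] at this ⊢
    linarith
  have hstep : rcdStep F W a z r = Function.update z r p := rfl
  -- Growth from the block minimizer towards `w`; the value at `w` is then expanded exactly around
  -- the old block `z r`.
  have h1 := add_le_of_isMinOn (convex_cone hB) hmem hw hmin'
    (l := partialGrad W a (Function.update z r p) r (w - p)) (q := blockSq W (w - p)) (fun t => by
      rw [dualObj_update_add W a z r p, add_sub_cancel_left, partialGrad_smul]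
      congr 1
      simp only [blockSq, wnormSq, Prod.smul_fst, Prod.smul_snd, Pi.smul_apply, smul_eq_mul,
        mul_add, Finset.mul_sum]
      congr 1
      · exact Finset.sum_congr rfl fun i _ => by ring
      · ring)
  have h2 := dualObj_update_add W a z r (z r) w
  rw [Function.update_eq_self] at h2
  rw [hstep, Function.update_self, ← h2]
  exact h1

lemma dualSolutions_nonempty (hF : ∀ r, IsAdmissible (F r)) (hW : ∀ i, 0 < W i)
    (hz : z ∈ feasible F) : (dualSolutions F W a).Nonempty := by
  obtain ⟨w, hw, hmin⟩ := exists_isMinOn_feasible (h := dualObj W a) hF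
    (basePolytope_nonempty_of_feasible hz)
    (by have := continuous_wnormSq W⁻¹; unfold dualObj; fun_prop)
    (fun z => le_add_of_nonneg_left (wnormSq_nonneg (fun i => (inv_pos.2 (hW i)).le) _))
  exact ⟨w, hw, hmin⟩

lemma dualOpt_eq {z' : Fin R → (Fin N → ℝ) × ℝ} (hz' : z' ∈ dualSolutions F W a) :
    dualOpt F W a = dualObj W a z' := by
  have : Nonempty (feasible F) := ⟨⟨z', hz'.1⟩⟩
  refine le_antisymm (ciInf_le ⟨dualObj W a z', ?_⟩ (⟨z', hz'.1⟩ : feasible F))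
    (le_ciInf fun w => hz'.2 w.2)
  rintro _ ⟨w, rfl⟩
  exact hz'.2 w.2

lemma convex_feasible (hz : z ∈ feasible F) : Convex ℝ (feasible F) := by
  intro p hp q hq s t hs ht hst r
  exact convex_cone (basePolytope_nonempty_of_feasible hz r) (hp r) (hq r) hs ht hst

/-- Quadratic growth of the dual objective from an optimal solution. -/
lemma dualObj_add_aggSq_le {z' : Fin R → (Fin N → ℝ) × ℝ} (hz' : z' ∈ dualSolutions F W a)
    (hz : z ∈ feasible F) : dualObj W a z' + aggSq W (z - z') ≤ dualObj W a z := by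
  refine add_le_of_isMinOn (convex_feasible hz) hz'.1 hz hz'.2
    (l := ∑ r, partialGrad W a z' r ((z - z') r)) fun t => ?_
  rw [dualObj_add, aggSq_smul, Finset.mul_sum]
  simp only [Pi.smul_apply, partialGrad_smul]

lemma eq_of_aggSq_eq_zero (hW : ∀ i, 0 < W i) {z w : Fin R → (Fin N → ℝ) × ℝ}
    (h : aggSq W (z - w) = 0) :
    ∑ r, (z r).1 = ∑ r, (w r).1 ∧ ∀ r, (z r).2 = (w r).2 := by
  have h1 : wnormSq W⁻¹ (∑ r, ((z - w) r).1) = 0 := by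
    have := wnormSq_nonneg (w := W⁻¹) (fun i => (inv_pos.2 (hW i)).le) (∑ r, ((z - w) r).1)
    have : 0 ≤ ∑ r, ((z - w) r).2 ^ 2 := Finset.sum_nonneg fun _ _ => sq_nonneg _
    unfold aggSq at h
    linarith
  have h2 : ∑ r, ((z - w) r).2 ^ 2 = 0 := by
    unfold aggSq at h
    linarith
  constructor
  · ext i
    have := (Finset.sum_eq_zero_iff_of_nonneg fun i _ =>
      mul_nonneg (inv_pos.2 (hW i)).le (sq_nonneg _)).1 h1 i (Finset.mem_univ i)
    have := (mul_eq_zero.1 this).resolve_left (inv_pos.2 (hW i)).ne'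
    have := pow_eq_zero_iff two_ne_zero |>.1 this
    simp only [Pi.sub_apply, Prod.fst_sub, Finset.sum_sub_distrib] at this
    exact sub_eq_zero.1 this
  · intro r
    have := (Finset.sum_eq_zero_iff_of_nonneg fun i _ => sq_nonneg _).1 h2 r (Finset.mem_univ r)
    exact sub_eq_zero.1 (pow_eq_zero_iff two_ne_zero |>.1 this)

/-- The aggregate distance to an optimal solution does not depend on the solution. -/
lemma aggSq_sub_eq (hW : ∀ i, 0 < W i) {z' w : Fin R → (Fin N → ℝ) × ℝ}
    (hz' : z' ∈ dualSolutions F W a) (hw : w ∈ dualSolutions F W a) :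
    aggSq W (z - z') = aggSq W (z - w) := by
  have h1 := dualObj_add_aggSq_le hz' hw.1
  have h2 : dualObj W a w ≤ dualObj W a z' := hw.2 hz'.1
  have h3 := aggSq_nonneg hW (w - z')
  obtain ⟨h4, h5⟩ := eq_of_aggSq_eq_zero hW (z := w) (w := z') (by linarith)
  simp only [aggSq, Pi.sub_apply, Prod.fst_sub, Prod.snd_sub, Finset.sum_sub_distrib, h4, h5]

lemma bddBelow_sqNorm (hW : ∀ i, 0 < W i) (z : Fin R → (Fin N → ℝ) × ℝ) :
    BddBelow (Set.range fun z' : dualSolutions F W a => sqNorm W (z - z'.1)) := by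
  refine ⟨0, ?_⟩
  rintro _ ⟨w, rfl⟩
  exact sqNorm_nonneg hW _

lemma distSqSolutions_le (hW : ∀ i, 0 < W i) {z' : Fin R → (Fin N → ℝ) × ℝ}
    (hz' : z' ∈ dualSolutions F W a) : distSqSolutions F W a z ≤ sqNorm W (z - z') :=
  ciInf_le (bddBelow_sqNorm hW z) (⟨z', hz'⟩ : dualSolutions F W a)

lemma dualError_nonneg (hW : ∀ i, 0 < W i) (hF : ∀ r, IsAdmissible (F r)) (hz : z ∈ feasible F) :
    0 ≤ dualError F W a z := by
  obtain ⟨z', hz'⟩ := dualSolutions_nonempty (a := a) hF hW hz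
  have h1 : dualObj W a z' ≤ dualObj W a z := hz'.2 hz
  have h2 : 0 ≤ distSqSolutions F W a z := by
    rw [distSqSolutions_eq]
    exact Real.iInf_nonneg fun w => sqNorm_nonneg hW _
  rw [dualError, dualOpt_eq hz']
  linarith

/-- In the three-point inequality with `w = z' r` the block norms cancel against the change of
`sqNorm`, leaving one partial derivative per `r`. Their sum is `g(z') - g(z) - aggSq`, because the
objective is quadratic. -/
lemma sum_dualObj_rcdStep_le (hF : ∀ r, IsAdmissible (F r)) (hW : ∀ i, 0 < W i)
    (hz : z ∈ feasible F) {z' : Fin R → (Fin N → ℝ) × ℝ} (hz' : z' ∈ dualSolutions F W a) :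
    ∑ r, (dualObj W a (rcdStep F W a z r) + sqNorm W (rcdStep F W a z r - z')) ≤
      (R - 1) * dualObj W a z + dualObj W a z' - aggSq W (z - z') + R * sqNorm W (z - z') := by
  have h1 : ∀ r, sqNorm W (rcdStep F W a z r - z') =
      sqNorm W (z - z') - blockSq W (z' r - z r) + blockSq W (z' r - rcdStep F W a z r r) := by
    intro r
    rw [sqNorm_eq, sqNorm_eq, ← Finset.add_sum_erase _ _ (Finset.mem_univ r),
      ← Finset.add_sum_erase _ (fun r => blockSq W ((z - z') r)) (Finset.mem_univ r),
      Finset.sum_congr (g := fun r' => blockSq W ((z - z') r')) rfl fun r' hr' => by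
        simp only [Pi.sub_apply, rcdStep]
        rw [Function.update_of_ne (Finset.ne_of_mem_erase hr')]]
    simp only [Pi.sub_apply]
    rw [blockSq_sub_comm W (z r), blockSq_sub_comm W (rcdStep F W a z r r)]
    ring
  have h2 : ∀ r, dualObj W a (rcdStep F W a z r) + sqNorm W (rcdStep F W a z r - z') ≤
      dualObj W a z + sqNorm W (z - z') + partialGrad W a z r ((z' - z) r) := by
    intro r
    have := dualObj_rcdStep_add_le (a := a) hF hW hz r (hz'.1 r)
    rw [h1, Pi.sub_apply]
    linarith
  have h3 := dualObj_add W a z (z' - z)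
  rw [add_sub_cancel] at h3
  refine (Finset.sum_le_sum fun r _ => h2 r).trans ?_
  rw [Finset.sum_add_distrib, aggSq_sub_comm]
  simp only [Finset.sum_const, Finset.card_univ, Fintype.card_fin, nsmul_eq_mul]
  linarith

/-- The average error contracts in one iteration, if the error bound holds with constant `μ`. -/
theorem sum_dualError_rcdStep_le (hF : ∀ r, IsAdmissible (F r)) (hW : ∀ i, 0 < W i)
    (hR : 0 < R) (hz : z ∈ feasible F) {μ : ℝ} (hμ : 1 ≤ μ)
    (hdist : ∀ z' ∈ dualSolutions F W a, distSqSolutions F W a z ≤ μ * aggSq W (z - z')) :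
    ∑ r, dualError F W a (rcdStep F W a z r) ≤ (R - μ⁻¹) * dualError F W a z := by
  obtain ⟨w, hw⟩ := dualSolutions_nonempty (a := a) hF hW hz
  have hR' : (0 : ℝ) < R := by exact_mod_cast hR
  have hμ0 : 0 < μ := one_pos.trans_le hμ
  have key : ∀ z' ∈ dualSolutions F W a, ∑ r, dualError F W a (rcdStep F W a z r) ≤
      (R - 1) * (dualObj W a z - dualObj W a w) - aggSq W (z - w) + R * sqNorm W (z - z') := by
    intro z' hz'
    have h1 := sum_dualObj_rcdStep_le hF hW hz hz'
    have h2 : ∑ r, dualError F W a (rcdStep F W a z r) ≤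
        ∑ r, (dualObj W a (rcdStep F W a z r) + sqNorm W (rcdStep F W a z r - z')
          - dualObj W a w) := by
      refine Finset.sum_le_sum fun r _ => ?_
      have := distSqSolutions_le hW hz' (z := rcdStep F W a z r)
      rw [dualError, dualOpt_eq hw]
      linarith
    rw [Finset.sum_sub_distrib] at h2
    simp only [Finset.sum_const, Finset.card_univ, Fintype.card_fin, nsmul_eq_mul] at h2
    rw [aggSq_sub_eq hW hz' hw] at h1
    have h3 : dualObj W a z' = dualObj W a w := le_antisymm (hz'.2 hw.1) (hw.2 hz'.1)
    linarith
  -- The bound holds for every optimal `z'`, used for all `r` at once, so it passes to the infimum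
  -- without a nearest solution being chosen.
  have hinf : (∑ r, dualError F W a (rcdStep F W a z r) -
      ((R - 1) * (dualObj W a z - dualObj W a w) - aggSq W (z - w))) / R ≤
      distSqSolutions F W a z := by
    have : Nonempty (dualSolutions F W a) := ⟨⟨w, hw⟩⟩
    rw [distSqSolutions_eq]
    refine le_ciInf fun z' => ?_
    rw [div_le_iff₀ hR']
    linarith [key z'.1 z'.2]
  rw [div_le_iff₀ hR'] at hinf
  have h1 : μ⁻¹ * distSqSolutions F W a z ≤ aggSq W (z - w) := by
    rw [inv_mul_le_iff₀ hμ0]; exact hdist w hw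
  have h2 : μ⁻¹ * (dualObj W a z - dualObj W a w) ≤ dualObj W a z - dualObj W a w := by
    have h3 : dualObj W a w ≤ dualObj W a z := hw.2 hz
    have h4 : μ⁻¹ ≤ 1 := inv_le_one_of_one_le₀ hμ
    exact mul_le_of_le_one_left (by linarith) h4
  rw [dualError, dualOpt_eq hw]
  linarith

/-- The error bound for the dual problem. -/
theorem distSqSolutions_le_aggSq (hF : ∀ r, IsAdmissible (F r)) (hD : ∀ i, 0 < degree F i)
    {β : ℝ} (hβ : 0 < β) (hN : 0 < N) (hW : W = β • degree F) (hz : z ∈ feasible F)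
    {z' : Fin R → (Fin N → ℝ) × ℝ} (hz' : z' ∈ dualSolutions F W a) :
    distSqSolutions F W a z ≤
      4 * ((N : ℝ) ^ 2 * max 1 (9 * β⁻¹) * maxRatio (degree F)) * aggSq W (z - z') := by
  obtain ⟨w, hw, hsum, hφ, hle⟩ := exists_sqNorm_sub_le hF hD hβ hN hW hz hz'.1
  have hWpos : ∀ i, 0 < W i := fun i => by rw [hW]; exact mul_pos hβ (hD i)
  -- A feasible point with the sum and multipliers of an optimal solution has the same objective
  -- value, hence is optimal.
  refine (distSqSolutions_le hWpos ⟨hw, fun v hv => ?_⟩).trans hle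
  have : dualObj W a w = dualObj W a z' := by simp only [dualObj, hsum, hφ]
  rw [Set.mem_ofPred_eq, this]
  exact hz'.2 hv

end Descent

/-! ### Hitting times of processes that contract in expectation. -/

section HittingTime

variable {Ω : Type*} [MeasurableSpace Ω] {μ : Measure Ω}

/-- Every time from `m` up to the first success at or after `m` is a failure and contributes `1`;
without such a success the series is infinite. -/
lemma iInf_le_add_tsum (p : ℕ → Prop) [DecidablePred p] (m : ℕ) :
    (⨅ (k : ℕ) (_ : p k), (k : ℝ≥0∞)) ≤ m + ∑' k, if p (m + k) then 0 else 1 := by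
  by_cases h : ∃ n, p (m + n)
  · have h1 : (⨅ (k : ℕ) (_ : p k), (k : ℝ≥0∞)) ≤ ((m + Nat.find h : ℕ) : ℝ≥0∞) :=
      iInf₂_le _ (Nat.find_spec h)
    refine h1.trans ?_
    push_cast
    refine add_le_add_right ?_ _
    refine le_trans (le_of_eq ?_) (ENNReal.sum_le_tsum (Finset.range (Nat.find h)))
    rw [Finset.sum_congr rfl fun k hk => if_neg (Nat.find_min h (Finset.mem_range.1 hk))]
    simp
  · push Not at h
    simp [h]

lemma pow_le_of_log_le {L : ℝ} (hL : 1 ≤ L) {ε : ℝ} (hε : 0 < ε) {k : ℕ}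
    (hk : L * Real.log (1 / ε) ≤ k) : (1 - L⁻¹) ^ k ≤ ε := by
  have hL0 : 0 < L := one_pos.trans_le hL
  have h1 : 1 - L⁻¹ ≤ Real.exp (-L⁻¹) := by
    have := Real.add_one_le_exp (-L⁻¹); linarith
  calc (1 - L⁻¹) ^ k ≤ Real.exp (-L⁻¹) ^ k :=
        pow_le_pow_left₀ (sub_nonneg.2 (inv_le_one_of_one_le₀ hL)) h1 k
    _ = Real.exp (-(L⁻¹ * k)) := by rw [← Real.exp_nat_mul]; ring_nf
    _ ≤ Real.exp (Real.log ε) := by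
        refine Real.exp_le_exp.2 ?_
        have h2 : Real.log (1 / ε) ≤ L⁻¹ * k := by rwa [← div_eq_inv_mul, le_div_iff₀' hL0]
        rw [one_div, Real.log_inv] at h2
        linarith
    _ = ε := Real.exp_log hε

/-- The expected hitting time of a small level for a process that contracts in expectation. -/
theorem lintegral_hitting_le [IsProbabilityMeasure μ] {X : ℕ → Ω → ℝ} {x₀ L ε : ℝ}
    (hX : ∀ k, Measurable (X k)) (hX0 : ∀ k ω, 0 ≤ X k ω) (hint : ∀ k, Integrable (X k) μ)
    (hstart : ∀ ω, X 0 ω = x₀) (hL : 1 ≤ L) (hdecay : ∀ k, ∫ ω, X k ω ∂μ ≤ (1 - L⁻¹) ^ k * x₀)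
    (hε : 0 < ε) (hε2 : ε ≤ 1 / 2) :
    ∫⁻ ω, (⨅ (k : ℕ) (_ : X k ω ≤ ε * x₀), (k : ℝ≥0∞)) ∂μ ≤
      ENNReal.ofReal (4 * L * Real.log (1 / ε)) := by
  classical
  have hL0 : 0 < L := one_pos.trans_le hL
  have hx₀ : 0 ≤ x₀ := by
    obtain ⟨ω⟩ : Nonempty Ω := nonempty_of_isProbabilityMeasure μ
    rw [← hstart ω]; exact hX0 0 ω
  -- Markov's inequality needs a positive level; for `x₀ = 0` the level is hit at time `0`.
  rcases hx₀.eq_or_lt with h0 | hpos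
  · have : ∀ ω, (⨅ (k : ℕ) (_ : X k ω ≤ ε * x₀), (k : ℝ≥0∞)) = 0 := fun ω =>
      le_antisymm ((iInf₂_le 0 (by rw [hstart, ← h0]; simp)).trans (by simp)) zero_le
    simp [this]
  have hq0 : 0 ≤ 1 - L⁻¹ := sub_nonneg.2 (inv_le_one_of_one_le₀ hL)
  have hq1 : 1 - L⁻¹ < 1 := by have := inv_pos.2 hL0; linarith
  set m := ⌈L * Real.log (1 / ε)⌉₊ with hm
  -- This is where `ε ≤ 1 / 2` matters: `m + L ≤ L log(1/ε) + 2 L`, and `2 ≤ 3 * 0.69`, which yields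
  -- the factor `4`.
  have hlog : (0.69 : ℝ) ≤ Real.log (1 / ε) := by
    have h1 : Real.log 2 ≤ Real.log (1 / ε) :=
      Real.log_le_log (by norm_num) (by rw [le_div_iff₀ hε]; linarith)
    have := Real.log_two_gt_d9
    linarith
  have hmle : (m : ℝ) ≤ L * Real.log (1 / ε) + 1 :=
    (Nat.ceil_lt_add_one (mul_nonneg hL0.le (by linarith))).le
  -- After `m` steps the mean is already below the level, so Markov's inequality leaves a geometric
  -- tail with sum `L`.
  have htail : ∀ k, μ {ω | ¬ X (m + k) ω ≤ ε * x₀} ≤ ENNReal.ofReal ((1 - L⁻¹) ^ k) := by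
    intro k
    have h1 := mul_meas_ge_le_integral_of_nonneg (μ := μ) (f := X (m + k))
      (Filter.Eventually.of_forall (hX0 _)) (hint _) (ε * x₀)
    have h2 := h1.trans (hdecay (m + k))
    have h3 : (1 - L⁻¹) ^ m ≤ ε := pow_le_of_log_le hL hε (Nat.le_ceil _)
    have h4 : (1 - L⁻¹) ^ (m + k) * x₀ ≤ ε * x₀ * (1 - L⁻¹) ^ k := by
      rw [pow_add]
      have := mul_le_mul_of_nonneg_right h3 (mul_nonneg (pow_nonneg hq0 k) hx₀)
      linarith
    have h5 := le_of_mul_le_mul_left (h2.trans h4) (mul_pos hε hpos)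
    refine (measure_mono fun ω hω => ?_).trans
      ((ENNReal.le_ofReal_iff_toReal_le (measure_ne_top μ _) (pow_nonneg hq0 k)).2 h5)
    exact (not_le.1 hω).le
  calc ∫⁻ ω, (⨅ (k : ℕ) (_ : X k ω ≤ ε * x₀), (k : ℝ≥0∞)) ∂μ
      ≤ ∫⁻ ω, (m + ∑' k, if X (m + k) ω ≤ ε * x₀ then 0 else 1) ∂μ :=
        lintegral_mono fun ω => iInf_le_add_tsum (fun k => X k ω ≤ ε * x₀) m
    _ = m + ∑' k, μ {ω | ¬ X (m + k) ω ≤ ε * x₀} := by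
        have hms : ∀ k, MeasurableSet {ω | X (m + k) ω ≤ ε * x₀} := fun k =>
          measurableSet_le (hX _) measurable_const
        rw [lintegral_add_left measurable_const, lintegral_const, measure_univ, mul_one,
          lintegral_tsum fun k => (Measurable.ite (hms k) measurable_const
            measurable_const).aemeasurable]
        congr 1
        refine tsum_congr fun k => ?_
        rw [show {ω | ¬ X (m + k) ω ≤ ε * x₀} = {ω | X (m + k) ω ≤ ε * x₀}ᶜ from rfl,
          ← lintegral_indicator_one (hms k).compl]
        refine lintegral_congr fun ω => ?_
        by_cases h : X (m + k) ω ≤ ε * x₀ <;> simp [Set.indicator, h]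
    _ ≤ m + ∑' k, ENNReal.ofReal ((1 - L⁻¹) ^ k) := by
        gcongr with k
        exact htail k
    _ = ENNReal.ofReal (m + L) := by
        rw [← ENNReal.ofReal_tsum_of_nonneg (fun k => pow_nonneg hq0 k)
          (summable_geometric_of_lt_one hq0 hq1), tsum_geometric_of_lt_one hq0 hq1,
          sub_sub_cancel, inv_inv, ENNReal.ofReal_add (Nat.cast_nonneg m) hL0.le,
          ENNReal.ofReal_natCast]
    _ ≤ ENNReal.ofReal (4 * L * Real.log (1 / ε)) := by
        refine ENNReal.ofReal_le_ofReal ?_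
        have := mul_le_mul_of_nonneg_left hlog hL0.le
        linarith

end HittingTime

/-! ### Random picks, expected contraction and relative accuracy. -/

section Sampling

variable {Ω : Type*} [MeasurableSpace Ω] {μ : Measure Ω} {N R : ℕ}
  {idx : ℕ → Ω → Fin R}

lemma rcdIter_congr (F : Fin R → Finset (Fin N) → ℝ) (W a : Fin N → ℝ)
    (z : Fin R → (Fin N → ℝ) × ℝ) {s t : ℕ → Fin R} {k : ℕ} (h : ∀ j < k, s j = t j) :
    rcdIter F W a z s k = rcdIter F W a z t k := by
  induction k with
  | zero => rfl
  | succ k ih =>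
    rw [rcdIter, rcdIter, ih fun j hj => h j (hj.trans k.lt_succ_self), h k k.lt_succ_self]

/-- The iterate `k` is a function of the first `k` picks. -/
lemma exists_rcdIter_eq (hR : 0 < R) (F : Fin R → Finset (Fin N) → ℝ) (W a : Fin N → ℝ)
    (z : Fin R → (Fin N → ℝ) × ℝ) (k : ℕ) :
    ∃ G : (Finset.range k → Fin R) → Fin R → (Fin N → ℝ) × ℝ,
      ∀ s : ℕ → Fin R, rcdIter F W a z s k = G fun j => s j := by
  refine ⟨fun v => rcdIter F W a z
    (fun j => if h : j ∈ Finset.range k then v ⟨j, h⟩ else ⟨0, hR⟩) k, fun s => ?_⟩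
  refine rcdIter_congr F W a z fun j hj => ?_
  simp [hj]

lemma measurable_past (h : IsUniformSampling μ idx) (S : Finset ℕ) :
    Measurable fun ω (j : S) => idx j ω :=
  measurable_pi_lambda _ fun j => h.measurable j

/-- The iterate factors through finitely many values of the past picks, so no regularity of `g` or
of the projection is needed. -/
lemma measurable_comp_rcdIter (h : IsUniformSampling μ idx) (hR : 0 < R)
    (F : Fin R → Finset (Fin N) → ℝ) (W a : Fin N → ℝ) (z : Fin R → (Fin N → ℝ) × ℝ)
    (g : (Fin R → (Fin N → ℝ) × ℝ) → ℝ) (k : ℕ) :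
    Measurable fun ω => g (rcdIter F W a z (fun k => idx k ω) k) := by
  obtain ⟨G, hG⟩ := exists_rcdIter_eq hR F W a z k
  simp only [hG]
  exact (measurable_of_finite fun v => g (G v)).comp (measurable_past h _)

lemma integrable_comp_rcdIter [IsProbabilityMeasure μ] (h : IsUniformSampling μ idx) (hR : 0 < R)
    (F : Fin R → Finset (Fin N) → ℝ) (W a : Fin N → ℝ) (z : Fin R → (Fin N → ℝ) × ℝ)
    (g : (Fin R → (Fin N → ℝ) × ℝ) → ℝ) (k : ℕ) :
    Integrable (fun ω => g (rcdIter F W a z (fun k => idx k ω) k)) μ := by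
  obtain ⟨G, hG⟩ := exists_rcdIter_eq hR F W a z k
  have hm := measurable_comp_rcdIter h hR F W a z g k
  simp only [hG] at hm ⊢
  refine Integrable.of_bound hm.aestronglyMeasurable (∑ v, ‖g (G v)‖)
    (Filter.Eventually.of_forall fun ω => ?_)
  exact Finset.single_le_sum (f := fun v => ‖g (G v)‖) (fun _ _ => norm_nonneg _)
    (Finset.mem_univ _)

/-- Splitting by the value of the current pick gives indicators independent of the past, each with
mean `1 / R`. This takes the place of conditioning. -/
lemma integral_rcdIter_succ [IsProbabilityMeasure μ] (h : IsUniformSampling μ idx) (hR : 0 < R)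
    (F : Fin R → Finset (Fin N) → ℝ) (W a : Fin N → ℝ) (z : Fin R → (Fin N → ℝ) × ℝ)
    (g : (Fin R → (Fin N → ℝ) × ℝ) → ℝ) (k : ℕ) :
    ∫ ω, g (rcdIter F W a z (fun k => idx k ω) (k + 1)) ∂μ =
      (R : ℝ)⁻¹ * ∫ ω, ∑ r, g (rcdStep F W a (rcdIter F W a z (fun k => idx k ω) k) r) ∂μ := by
  classical
  have hsplit : ∀ ω, g (rcdIter F W a z (fun k => idx k ω) (k + 1)) =
      ∑ r, (if idx k ω = r then (1 : ℝ) else 0) *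
        g (rcdStep F W a (rcdIter F W a z (fun k => idx k ω) k) r) := by
    intro ω
    simp [rcdIter]
  have hind : ∀ r, ∫ ω, (if idx k ω = r then (1 : ℝ) else 0) ∂μ = (R : ℝ)⁻¹ := by
    intro r
    have h1 : (fun ω => if idx k ω = r then (1 : ℝ) else 0) =
        (idx k ⁻¹' {r}).indicator 1 := by
      ext ω; simp [Set.indicator]
    rw [h1, integral_indicator_one (h.measurable k (measurableSet_singleton r)), measureReal_def,
      h.uniform]
    simp
  have hprod : ∀ r, ∫ ω, (if idx k ω = r then (1 : ℝ) else 0) *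
      g (rcdStep F W a (rcdIter F W a z (fun k => idx k ω) k) r) ∂μ =
      (R : ℝ)⁻¹ * ∫ ω, g (rcdStep F W a (rcdIter F W a z (fun k => idx k ω) k) r) ∂μ := by
    intro r
    obtain ⟨G, hG⟩ := exists_rcdIter_eq hR F W a z k
    have hindep := h.indep.indepFun_finset {k} (Finset.range k) (by simp) h.measurable
    rw [← hind r]
    simp only [hG]
    exact hindep.integral_fun_comp_mul_comp
      (f := fun v => if v ⟨k, Finset.mem_singleton_self k⟩ = r then (1 : ℝ) else 0)
      (g := fun v => g (rcdStep F W a (G v) r))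
      (measurable_past h _).aemeasurable (measurable_past h _).aemeasurable
      (measurable_of_finite _).aestronglyMeasurable (measurable_of_finite _).aestronglyMeasurable
  have hint : ∀ r, Integrable
      (fun ω => g (rcdStep F W a (rcdIter F W a z (fun k => idx k ω) k) r)) μ := fun r =>
    integrable_comp_rcdIter h hR F W a z (fun z => g (rcdStep F W a z r)) k
  simp only [hsplit]
  rw [integral_finsetSum _ fun r _ => ?_, integral_finsetSum _ fun r _ => hint r, Finset.mul_sum]
  · exact Finset.sum_congr rfl fun r _ => hprod r
  · refine (hint r).bdd_mul (c := 1) ?_ (Filter.Eventually.of_forall fun ω => ?_)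
    · exact ((measurable_of_finite fun j => if j = r then (1 : ℝ) else 0).comp
        (h.measurable k)).aestronglyMeasurable
    · split_ifs <;> simp

variable {F : Fin R → Finset (Fin N) → ℝ} {W a : Fin N → ℝ} {z : Fin R → (Fin N → ℝ) × ℝ} {β : ℝ}

lemma one_le_complexityFactor (hD : ∀ i, 0 < degree F i) (hN : 0 < N) (hR : 0 < R) :
    1 ≤ complexityFactor F β := by
  have h1 : (1 : ℝ) ≤ N := by exact_mod_cast hN
  have h2 : (1 : ℝ) ≤ R := by exact_mod_cast hR
  exact one_le_mul_of_one_le_of_one_le (one_le_mul_of_one_le_of_one_le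
    (one_le_mul_of_one_le_of_one_le (one_le_pow₀ h1) h2) (le_max_left _ _))
    (one_le_maxRatio hD hN)

/-- Linear convergence of the expected error. -/
theorem integral_dualError_le [IsProbabilityMeasure μ]
    (hF : ∀ r, IsAdmissible (F r)) (hD : ∀ i, 0 < degree F i)
    (hβ : 0 < β) (hN : 0 < N) (hR : 0 < R) (hW : W = β • degree F) (hz : z ∈ feasible F)
    (h : IsUniformSampling μ idx) (k : ℕ) :
    ∫ ω, dualError F W a (rcdIter F W a z (fun k => idx k ω) k) ∂μ ≤
      (1 - (4 * complexityFactor F β)⁻¹) ^ k * dualError F W a z := by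
  have hWpos : ∀ i, 0 < W i := fun i => by rw [hW]; exact mul_pos hβ (hD i)
  have hR' : (1 : ℝ) ≤ R := by exact_mod_cast hR
  set c := 4 * ((N : ℝ) ^ 2 * max 1 (9 * β⁻¹) * maxRatio (degree F)) with hc
  have hc1 : 1 ≤ c := by
    have h1 : (1 : ℝ) ≤ N := by exact_mod_cast hN
    have := one_le_mul_of_one_le_of_one_le (one_le_mul_of_one_le_of_one_le
      (one_le_pow₀ (n := 2) h1) (le_max_left 1 (9 * β⁻¹))) (one_le_maxRatio hD hN)
    linarith
  -- `c` is the error bound constant, and uniform averaging over `R` blocks turns the rate `1 / c`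
  -- into `1 / (R * c)`.
  have hK : 4 * complexityFactor F β = R * c := by
    rw [hc, complexityFactor, maxRatio]; ring
  have hK1 : 1 ≤ (R : ℝ) * c := one_le_mul_of_one_le_of_one_le hR' hc1
  rw [hK]
  induction k with
  | zero => simp [rcdIter]
  | succ k ih =>
    rw [integral_rcdIter_succ h hR F W a z (dualError F W a) k]
    have hstep : ∫ ω, ∑ r, dualError F W a
        (rcdStep F W a (rcdIter F W a z (fun k => idx k ω) k) r) ∂μ ≤
        ∫ ω, (R - c⁻¹) * dualError F W a (rcdIter F W a z (fun k => idx k ω) k) ∂μ := by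
      refine integral_mono
        (integrable_comp_rcdIter h hR F W a z
          (fun z => ∑ r, dualError F W a (rcdStep F W a z r)) k)
        ((integrable_comp_rcdIter h hR F W a z (dualError F W a) k).const_mul _) fun ω => ?_
      have hmem := rcdIter_mem_feasible (a := a) hF hWpos hz (fun k => idx k ω) k
      exact sum_dualError_rcdStep_le hF hWpos hR hmem hc1 fun z' hz' =>
        distSqSolutions_le_aggSq hF hD hβ hN hW hmem hz'
    rw [integral_const_mul] at hstep
    have h1 := mul_le_mul_of_nonneg_left hstep (inv_nonneg.2 (Nat.cast_nonneg (α := ℝ) R))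
    refine h1.trans ?_
    have h2 : (R : ℝ)⁻¹ * ((R - c⁻¹) *
        ∫ ω, dualError F W a (rcdIter F W a z (fun k => idx k ω) k) ∂μ) =
        (1 - (R * c)⁻¹) * ∫ ω, dualError F W a (rcdIter F W a z (fun k => idx k ω) k) ∂μ := by
      have : (R : ℝ) ≠ 0 := by positivity
      have : c ≠ 0 := by positivity
      field_simp
    rw [h2, pow_succ', mul_assoc]
    exact mul_le_mul_of_nonneg_left ih (sub_nonneg.2 (inv_le_one_of_one_le₀ hK1))

lemma iterationsToError_anti (s : ℕ → Fin R) {η η' : ℝ} (h : η' ≤ η) :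
    iterationsToError F W a z s η ≤ iterationsToError F W a z s η' :=
  iInf_mono fun _ => iInf_mono' fun hk => ⟨hk.trans h, le_rfl⟩

/-- Convergence of random coordinate descent to relative accuracy. -/
theorem rcd_relative_accuracy [IsProbabilityMeasure μ]
    (hF : ∀ r, IsAdmissible (F r)) (hD : ∀ i, 0 < degree F i)
    (hβ : 0 < β) (hN : 0 < N) (hR : 0 < R) (hW : W = β • degree F) (hz : z ∈ feasible F)
    (h : IsUniformSampling μ idx) {ε : ℝ} (hε : 0 < ε) (hε2 : ε ≤ 1 / 2) :
    ∫⁻ ω, iterationsToError F W a z (fun k => idx k ω) (ε * dualError F W a z) ∂μ ≤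
        ENNReal.ofReal (16 * complexityFactor F β * Real.log (1 / ε)) ∧
      ∀ k : ℕ, 16 * complexityFactor F β * Real.log (1 / ε) ≤ k →
        ∫ ω, dualError F W a (rcdIter F W a z (fun k => idx k ω) k) ∂μ ≤
          ε * dualError F W a z := by
  have hWpos : ∀ i, 0 < W i := fun i => by rw [hW]; exact mul_pos hβ (hD i)
  have hK := one_le_complexityFactor (β := β) hD hN hR
  have hlog : 0 ≤ Real.log (1 / ε) :=
    Real.log_nonneg (by rw [le_div_iff₀ hε]; linarith)
  have hE0 := dualError_nonneg (a := a) hWpos hF hz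
  constructor
  · have := lintegral_hitting_le (μ := μ) (ε := ε)
      (X := fun k ω => dualError F W a (rcdIter F W a z (fun k => idx k ω) k))
      (measurable_comp_rcdIter h hR F W a z _)
      (fun k ω => dualError_nonneg hWpos hF (rcdIter_mem_feasible hF hWpos hz _ k))
      (integrable_comp_rcdIter h hR F W a z _) (fun _ => rfl)
      (L := 4 * complexityFactor F β) (by linarith)
      (integral_dualError_le hF hD hβ hN hR hW hz h) hε hε2
    refine this.trans (le_of_eq ?_)
    ring_nf
  · intro k hk
    refine (integral_dualError_le hF hD hβ hN hR hW hz h k).trans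
      (mul_le_mul_of_nonneg_right (pow_le_of_log_le (by linarith) hε ?_) hE0)
    refine le_trans ?_ hk
    exact mul_le_mul_of_nonneg_right (by linarith) hlog

end Sampling

end QDSFM

/-! ### The convergence theorem. -/

theorem corollary4p1 :
    ∃ C : ℝ, 0 < C ∧
      ∀ (N R : ℕ) (F : Fin R → Finset (Fin N) → ℝ) (a : Fin N → ℝ) (β : ℝ) (W : Fin N → ℝ)
        (φ₀ : Fin R → ℝ) (z₀ : Fin R → (Fin N → ℝ) × ℝ)
        (Ω : Type*) [MeasurableSpace Ω] (μ : Measure Ω) [IsProbabilityMeasure μ]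
        (idx : ℕ → Ω → Fin R),
        0 < N →
        (∀ r, QDSFM.IsAdmissible (F r)) →
        (∀ i, ∃ r, i ∈ QDSFM.incidentSet (F r)) →
        0 < β →
        W = β • QDSFM.degree F →
        (∀ r, z₀ r = (0, φ₀ r)) →
        z₀ ∈ QDSFM.feasible F →
        QDSFM.IsUniformSampling μ idx →
        ∀ ε : ℝ, 0 < ε → ε ≤ 1 / 2 →
          -- accuracy relative to the initial error
          (∫⁻ ω, QDSFM.iterationsToError F W a z₀ (fun k => idx k ω)
                (ε * QDSFM.dualError F W a z₀) ∂μ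
              ≤ ENNReal.ofReal (C * QDSFM.complexityFactor F β * Real.log (1 / ε)) ∧
            ∀ k : ℕ, C * QDSFM.complexityFactor F β * Real.log (1 / ε) ≤ k →
              Integrable (fun ω => QDSFM.dualError F W a
                (QDSFM.rcdIter F W a z₀ (fun k => idx k ω) k)) μ ∧
              ∫ ω, QDSFM.dualError F W a (QDSFM.rcdIter F W a z₀ (fun k => idx k ω) k) ∂μ
                ≤ ε * QDSFM.dualError F W a z₀) ∧
          -- absolute accuracy, for small tolerances
          (ε * QDSFM.dualError F W a z₀ ≤ 1 →
            ∫⁻ ω, QDSFM.iterationsToError F W a z₀ (fun k => idx k ω) ε ∂μ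
              ≤ ENNReal.ofReal (C * QDSFM.complexityFactor F β * Real.log (1 / ε)) ∧
            ∀ k : ℕ, C * QDSFM.complexityFactor F β * Real.log (1 / ε) ≤ k →
              ∫ ω, QDSFM.dualError F W a (QDSFM.rcdIter F W a z₀ (fun k => idx k ω) k) ∂μ
                ≤ ε) := by
  -- The factor `16` for relative accuracy combines `4` from the contraction rate with `4` from the
  -- hitting time; it is doubled by `log (1 / ε ^ 2) = 2 log (1 / ε)` in the absolute case.
  refine ⟨32, by norm_num, ?_⟩
  intro N R F a β W φ₀ z₀ Ω _ μ _ idx hN hF hinc hβ hW _ hz h ε hε hε2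
  have hD : ∀ i, 0 < QDSFM.degree F i := fun i => QDSFM.degree_pos F (hinc i)
  have hR : 0 < R := (hinc ⟨0, hN⟩).elim fun r _ => r.pos
  have hK := QDSFM.one_le_complexityFactor (β := β) hD hN hR
  have hlog : 0 ≤ Real.log (1 / ε) :=
    Real.log_nonneg (by rw [le_div_iff₀ hε]; linarith)
  have hmono : 16 * QDSFM.complexityFactor F β * Real.log (1 / ε) ≤
      32 * QDSFM.complexityFactor F β * Real.log (1 / ε) :=
    mul_le_mul_of_nonneg_right (by linarith) hlog
  have hsq : 16 * QDSFM.complexityFactor F β * Real.log (1 / ε ^ 2) =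
      32 * QDSFM.complexityFactor F β * Real.log (1 / ε) := by
    rw [one_div, one_div, Real.log_inv, Real.log_inv, Real.log_pow]
    push_cast
    ring
  obtain ⟨h1, h2⟩ := QDSFM.rcd_relative_accuracy (a := a) hF hD hβ hN hR hW hz h hε hε2
  obtain ⟨h3, h4⟩ := QDSFM.rcd_relative_accuracy (a := a) hF hD hβ hN hR hW hz h
    (ε := ε ^ 2) (by positivity) (by nlinarith)
  rw [hsq] at h3 h4
  refine ⟨⟨h1.trans (ENNReal.ofReal_le_ofReal hmono), fun k hk =>
    ⟨QDSFM.integrable_comp_rcdIter h hR F W a z₀ _ k, h2 k (hmono.trans hk)⟩⟩, fun hsmall => ?_⟩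
  have hle : ε ^ 2 * QDSFM.dualError F W a z₀ ≤ ε := by
    have := mul_le_mul_of_nonneg_left hsmall hε.le
    linarith
  exact ⟨(lintegral_mono fun ω => QDSFM.iterationsToError_anti _ hle).trans h3,
    fun k hk => (h4 k hk).trans hle⟩
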